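/- Let $(M,g)$ be a closed (compact, without boundary) connected smooth Riemannian manifold of dimension $4$, with volume measure $dV$. Let $a,c\in C^\infty(M)$ with $a>0$ on $M$, and consider the operator $$Lu=-\operatorname{div}(a\nabla u)+c\,u .$$ Assume that its first eigenvalue is non-negative: $$\lambda_1:=\inf_{u\in H^1(M),\,u\not\equiv0}\frac{\int_M\left(a|\nabla u|^2+c\,u^2\right)dV}{\int_M u^2\,dV}\;\ge\;0 .$$ For positive functions $u$ on $M$ put $$\mathfrak D(u)=\left(\int_M u^{-4}\,dV\right)^{\frac12}\int_M\left(a|\nabla u|^2+c\,u^2\right)dV,\qquad \hat{\mathcal D}=\inf_{0<u\in C^\infty(M)}\mathfrak D(u).$$ Solutions are understood in the classical sense, i.e. they are functions in $C^2(M)$ that satisfy the equation at every point of $M$. (i) If $u_1>0$ and $u_2>0$ are two solutions of $$Lu=\mathfrak D(u)\left(\int_M u^{-4}\,dV\right)^{-\frac32}u^{-5}\quad\text{in }M,$$ then there is a constant $\beta>0$ such that $u_1=\beta u_2$ in $M$. (ii) If $u_1>0$ and $u_2>0$ are two solutions of $$Lu=\hat{\mathcal D}\left(\int_M u^{-4}\,dV\right)^{-\frac32}u^{-5}\quad\text{in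 }M,$$ then there is a constant $\beta>0$ such that $u_1=\beta u_2$ in $M$. -/

import Mathlib

open Bundle MeasureTheory Filter
open scoped Manifold ContDiff Topology ENNReal

noncomputable section

/-! Riemannian calculus on an `n`-dimensional smooth manifold without boundary (charts in
`EuclideanSpace ℝ (Fin n)`), the metric being given by an inner product on each tangent space. -/

namespace ConformalPDE

section Calculus

variable {n : ℕ} {M : Type*} [TopologicalSpace M] [ChartedSpace (EuclideanSpace ℝ (Fin n)) M]

/-- The coordinate vector field `∂ⱼ` of the chart centred at `p`, at the point with coordinates
`y`: the image of the `j`-th basis vector under the differential of the inverse chart. -/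
def coordVec (p : M) (y : EuclideanSpace ℝ (Fin n)) (j : Fin n) :
    TangentSpace (𝓡 n) ((chartAt (EuclideanSpace ℝ (Fin n)) p).symm y) :=
  mfderiv (𝓡 n) (𝓡 n) (chartAt (EuclideanSpace ℝ (Fin n)) p).symm y
    (EuclideanSpace.single j (1 : ℝ) : EuclideanSpace ℝ (Fin n))

/-- The `j`-th component, in the chart centred at `p`, of the vector field `X`, as a function of
the coordinates `y`. -/
def vecComponent (X : ∀ x : M, TangentSpace (𝓡 n) x) (p : M) (j : Fin n)
    (y : EuclideanSpace ℝ (Fin n)) : ℝ :=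
  let v : EuclideanSpace ℝ (Fin n) :=
    mfderiv (𝓡 n) (𝓡 n) (chartAt (EuclideanSpace ℝ (Fin n)) p)
      ((chartAt (EuclideanSpace ℝ (Fin n)) p).symm y)
      (X ((chartAt (EuclideanSpace ℝ (Fin n)) p).symm y))
  v j

variable [RiemannianBundle (fun x : M ↦ TangentSpace (𝓡 n) x)]

/-- The matrix `gⱼₖ` of the metric in the chart centred at `p`. -/
def gramMatrix (p : M) (y : EuclideanSpace ℝ (Fin n)) : Matrix (Fin n) (Fin n) ℝ :=
  Matrix.of fun j k ↦ inner ℝ (coordVec p y j) (coordVec p y k)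

/-- The density `√det(gⱼₖ)` of the Riemannian volume in the chart centred at `p`. -/
def volDensity (p : M) (y : EuclideanSpace ℝ (Fin n)) : ℝ :=
  √ (gramMatrix p y).det

/-- The gradient of `u`, characterized by `⟨∇u(x), v⟩ = du(x) v` for all tangent vectors `v`. -/
def grad (u : M → ℝ) (x : M) : TangentSpace (𝓡 n) x :=
  haveI : FiniteDimensional ℝ (TangentSpace (𝓡 n) x) :=
    inferInstanceAs (FiniteDimensional ℝ (EuclideanSpace ℝ (Fin n)))
  haveI : CompleteSpace (TangentSpace (𝓡 n) x) := FiniteDimensional.complete ℝ _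
  (InnerProductSpace.toDual ℝ (TangentSpace (𝓡 n) x)).symm (mfderiv (𝓡 n) 𝓘(ℝ, ℝ) u x)

/-- The Riemannian divergence, `div X = (1 / √det g) ∑ⱼ ∂ⱼ (√det g Xʲ)`, computed at `x` in the
chart centred at `x`. -/
def divergence (X : ∀ x : M, TangentSpace (𝓡 n) x) (x : M) : ℝ :=
  (volDensity x (chartAt (EuclideanSpace ℝ (Fin n)) x x))⁻¹ *
    ∑ j : Fin n, fderiv ℝ (fun y ↦ volDensity x y * vecComponent X x j y)
      (chartAt (EuclideanSpace ℝ (Fin n)) x x) (EuclideanSpace.single j (1 : ℝ))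

variable (n) in
/-- The operator `L u = -div(a ∇u) + c u`. -/
def opL (a c u : M → ℝ) (x : M) : ℝ :=
  -divergence (n := n) (fun z ↦ a z • grad u z) x + c x * u x

end Calculus

section Volume

variable {n : ℕ} {M : Type*} [TopologicalSpace M] [ChartedSpace (EuclideanSpace ℝ (Fin n)) M]
  [RiemannianBundle (fun x : M ↦ TangentSpace (𝓡 n) x)] [MeasurableSpace M]

/-- The Riemannian volume of the domain of the chart centred at `p`: the image under the inverse
chart of the measure `√det(gⱼₖ) dy`. -/
def chartVolume (p : M) : Measure M :=
  Measure.map (chartAt (EuclideanSpace ℝ (Fin n)) p).symm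
    ((volume.restrict (chartAt (EuclideanSpace ℝ (Fin n)) p).target).withDensity
      fun y ↦ ENNReal.ofReal (volDensity p y))

variable (n M) in
/-- The Riemannian volume measure `dV` of a closed manifold, glued from the chart volumes by a
smooth partition of unity subordinate to the chart domains. (The result does not depend on the
partition of unity.) -/
def riemannianVolume [T2Space M] [CompactSpace M] [IsManifold (𝓡 n) ∞ M] : Measure M :=
  Measure.sum fun p : M ↦ (chartVolume (n := n) p).withDensity fun x ↦
    ENNReal.ofReal
      ((SmoothPartitionOfUnity.exists_isSubordinate_chartAt_source (𝓡 n) M).choose p x)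

end Volume

section Functionals

variable {n : ℕ} {M : Type*} [TopologicalSpace M] [T2Space M] [CompactSpace M]
  [ChartedSpace (EuclideanSpace ℝ (Fin n)) M] [IsManifold (𝓡 n) ∞ M]
  [RiemannianBundle (fun x : M ↦ TangentSpace (𝓡 n) x)] [MeasurableSpace M]

/-- `u` belongs to the Sobolev space `H¹(M)` and has weak gradient `X`. Here `H¹(M)` is the
completion of `C¹(M)` in the norm `(∫ u² + |∇u|²)^{1/2}`, realized as a space of functions in
`L²(M)`, with gradients in `L²`. A vector field is measurable if its inner products with smooth
vector fields are. -/
structure HasSobolevGradient (u : M → ℝ) (X : ∀ x : M, TangentSpace (𝓡 n) x) : Prop where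
  memLp : MemLp u 2 (riemannianVolume n M)
  aestronglyMeasurable_inner : ∀ Y : ∀ x : M, TangentSpace (𝓡 n) x,
    ContMDiff (𝓡 n) (𝓡 n).tangent ∞ (fun x ↦ (⟨x, Y x⟩ : TangentBundle (𝓡 n) M)) →
      AEStronglyMeasurable (fun x ↦ (inner ℝ (X x) (Y x) : ℝ)) (riemannianVolume n M)
  integrable_norm_sq : Integrable (fun x ↦ ‖X x‖ ^ 2) (riemannianVolume n M)
  approx : ∃ φ : ℕ → M → ℝ, (∀ k, ContMDiff (𝓡 n) 𝓘(ℝ, ℝ) 1 (φ k)) ∧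
    Tendsto (fun k ↦ ∫⁻ x, ‖φ k x - u x‖ₑ ^ 2 ∂(riemannianVolume n M)) atTop (𝓝 0) ∧
    Tendsto (fun k ↦ ∫⁻ x, ‖grad (φ k) x - X x‖ₑ ^ 2 ∂(riemannianVolume n M)) atTop (𝓝 0)

variable (n) in
/-- The first eigenvalue of `L`: the infimum over all `u ∈ H¹(M)`, `u ≢ 0`, of the Rayleigh
quotient `∫ (a |∇u|² + c u²) / ∫ u²`. (For bounded `c` and `a ≥ 0` the set of quotients is bounded
below, and it is non-empty.) -/
def firstEigenvalue (a c : M → ℝ) : ℝ :=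
  sInf {r : ℝ | ∃ (u : M → ℝ) (X : ∀ x : M, TangentSpace (𝓡 n) x),
    HasSobolevGradient u X ∧ ¬ (u =ᵐ[riemannianVolume n M] 0) ∧
    r = (∫ x, (a x * ‖X x‖ ^ 2 + c x * u x ^ 2) ∂(riemannianVolume n M)) /
      ∫ x, u x ^ 2 ∂(riemannianVolume n M)}

variable (n) in
/-- `∫ u⁻⁴ dV`. -/
def intInvFour (u : M → ℝ) : ℝ :=
  ∫ x, (u x ^ 4)⁻¹ ∂(riemannianVolume n M)

variable (n) in
/-- The functional `𝔇(u) = (∫ u⁻⁴ dV)^{1/2} ∫ (a |∇u|² + c u²) dV`. -/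
def functionalD (a c u : M → ℝ) : ℝ :=
  intInvFour n u ^ (1 / 2 : ℝ) *
    ∫ x, (a x * ‖(grad u x : TangentSpace (𝓡 n) x)‖ ^ 2 + c x * u x ^ 2) ∂(riemannianVolume n M)

variable (n) in
/-- The infimum of `𝔇` over the positive smooth functions on `M`. -/
def infD (a c : M → ℝ) : ℝ :=
  sInf {r : ℝ | ∃ u : M → ℝ, ContMDiff (𝓡 n) 𝓘(ℝ, ℝ) ∞ u ∧ (∀ x, 0 < u x) ∧
    r = functionalD n a c u}

variable (n) in
/-- `u` is a positive classical solution on `M` of `L u = d (∫ u⁻⁴ dV)^{-3/2} u⁻⁵`. -/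
structure IsPositiveSolution (a c : M → ℝ) (d : ℝ) (u : M → ℝ) : Prop where
  contMDiff : ContMDiff (𝓡 n) 𝓘(ℝ, ℝ) 2 u
  pos : ∀ x, 0 < u x
  eqn : ∀ x, opL n a c u x = d * intInvFour n u ^ (-(3 / 2) : ℝ) * (u x ^ 5)⁻¹

end Functionals

end ConformalPDE

end

/-! Both equations have the form `L u = K u⁻⁵` with a constant `K ≥ 0`: a non-negative first
eigenvalue makes the quadratic form `Q(w) = ∫ (a |∇w|² + c w²)` non-negative on `C²` functions
(`energy_nonneg`), so `functionalD` and its infimum are non-negative. Only this sign matters, and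
the constants may differ for the two solutions (`exists_eq_mul_of_opL_eq`).

If both constants are positive, rescale to `v = s u₁`, `w = t u₂` with `L v = v⁻⁵` and `L w = w⁻⁵`.
Green's identity gives `Q(v - w) = ∫ (v - w)(v⁻⁵ - w⁻⁵) ≤ 0`, because `r ↦ r⁻⁵` is decreasing. Since
`Q ≥ 0`, the integrand vanishes everywhere and `v = w`. If one constant is zero, symmetry of `L`
forces the other to be zero, and an identity of Picone type gives `∫ a u₂² |∇(u₁/u₂)|² = 0`, so the
quotient is constant on the connected manifold.

The geometric input is Green's identity `integral_mul_opL`, that is, the divergence theorem. It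
needs two facts about the definitions: in each chart the glued measure is the chart volume
(`riemannianVolume_restrict_source`), and `divergence`, evaluated at every point in that point's own
chart, does not depend on the chart (`chartDivergence_eqOn`). -/

noncomputable section

namespace ConformalPDE

/-! ### Charts, transition maps, and the metric in coordinates. -/

section Coordinates

variable {n : ℕ} {M : Type*} [TopologicalSpace M] [ChartedSpace (EuclideanSpace ℝ (Fin n)) M]

/-- The differential of the inverse chart centred at `p`, as an endomorphism of the model. -/
def frame (p : M) (y : EuclideanSpace ℝ (Fin n)) :
    EuclideanSpace ℝ (Fin n) →L[ℝ] EuclideanSpace ℝ (Fin n) :=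
  mfderiv (𝓡 n) (𝓡 n) (chartAt (EuclideanSpace ℝ (Fin n)) p).symm y

/-- The differential of the chart centred at `p`, as an endomorphism of the model. -/
def coframe (p : M) (x : M) :
    EuclideanSpace ℝ (Fin n) →L[ℝ] EuclideanSpace ℝ (Fin n) :=
  mfderiv (𝓡 n) (𝓡 n) (chartAt (EuclideanSpace ℝ (Fin n)) p) x

/-- The transition map from the chart centred at `p` to the chart centred at `q`. -/
def transition (p q : M) : OpenPartialHomeomorph (EuclideanSpace ℝ (Fin n))
    (EuclideanSpace ℝ (Fin n)) :=
  (chartAt (EuclideanSpace ℝ (Fin n)) p).symm ≫ₕ chartAt (EuclideanSpace ℝ (Fin n)) q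

theorem transition_apply (p q : M) (y : EuclideanSpace ℝ (Fin n)) :
    transition p q y = chartAt (EuclideanSpace ℝ (Fin n)) q
      ((chartAt (EuclideanSpace ℝ (Fin n)) p).symm y) := rfl

theorem mem_transition_source {p q : M} {y : EuclideanSpace ℝ (Fin n)} :
    y ∈ (transition p q).source ↔ y ∈ (chartAt (EuclideanSpace ℝ (Fin n)) p).target ∧
      (chartAt (EuclideanSpace ℝ (Fin n)) p).symm y ∈
        (chartAt (EuclideanSpace ℝ (Fin n)) q).source := by
  simp [transition]

section Smooth

variable [IsManifold (𝓡 n) ∞ M]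

theorem contDiffOn_transition (p q : M) :
    ContDiffOn ℝ ∞ (transition (n := n) p q) (transition (n := n) p q).source := by
  rw [← contMDiffOn_iff_contDiffOn]
  refine (contMDiffOn_chart (I := 𝓡 n) (x := q)).comp
    ((contMDiffOn_chart_symm (I := 𝓡 n) (x := p)).mono fun y hy ↦
      (mem_transition_source.1 hy).1) fun y hy ↦ (mem_transition_source.1 hy).2

theorem hasFDerivAt_transition {p q : M} {y : EuclideanSpace ℝ (Fin n)}
    (hy : y ∈ (transition p q).source) :
    HasFDerivAt (transition p q) (fderiv ℝ (transition p q) y) y :=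
  (((contDiffOn_transition p q).contDiffAt
    ((transition p q).open_source.mem_nhds hy)).differentiableAt (by simp)).hasFDerivAt

theorem mdifferentiableAt_chart_symm {p : M} {y : EuclideanSpace ℝ (Fin n)}
    (hy : y ∈ (chartAt (EuclideanSpace ℝ (Fin n)) p).target) :
    MDifferentiableAt (𝓡 n) (𝓡 n) (chartAt (EuclideanSpace ℝ (Fin n)) p).symm y :=
  have : IsManifold (𝓡 n) 1 M := .of_le (n := ∞) (by simp)
  mdifferentiableAt_atlas_symm (chart_mem_atlas _ p) hy

theorem frame_comp_coframe {p x : M} (hx : x ∈ (chartAt (EuclideanSpace ℝ (Fin n)) p).source) :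
    (frame p (chartAt (EuclideanSpace ℝ (Fin n)) p x)).comp (coframe p x) =
      ContinuousLinearMap.id ℝ _ := by
  have : IsManifold (𝓡 n) 1 M := .of_le (n := ∞) (by simp)
  exact (mdifferentiable_chart (I := 𝓡 n) p).symm_comp_deriv hx

theorem coframe_comp_frame {p : M} {y : EuclideanSpace ℝ (Fin n)}
    (hy : y ∈ (chartAt (EuclideanSpace ℝ (Fin n)) p).target) :
    (coframe p ((chartAt (EuclideanSpace ℝ (Fin n)) p).symm y)).comp (frame p y) =
      ContinuousLinearMap.id ℝ _ := by
  have : IsManifold (𝓡 n) 1 M := .of_le (n := ∞) (by simp)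
  exact (mdifferentiable_chart (I := 𝓡 n) p).comp_symm_deriv hy

theorem frame_injective {p : M} {y : EuclideanSpace ℝ (Fin n)}
    (hy : y ∈ (chartAt (EuclideanSpace ℝ (Fin n)) p).target) :
    Function.Injective (frame p y) :=
  Function.LeftInverse.injective fun v ↦ DFunLike.congr_fun (coframe_comp_frame hy) v

/-- Chain rule: near `y` the inverse chart at `p` is the inverse chart at `q` after the transition
map. -/
theorem frame_eq_comp_transition {p q : M} {y : EuclideanSpace ℝ (Fin n)}
    (hy : y ∈ (transition p q).source) :
    frame p y = (frame q (transition p q y)).comp (fderiv ℝ (transition p q) y) := by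
  have hy' := mem_transition_source.1 hy
  have hτ : MDifferentiableAt (𝓡 n) (𝓡 n) (transition p q) y :=
    (hasFDerivAt_transition hy).differentiableAt.mdifferentiableAt
  have hq : MDifferentiableAt (𝓡 n) (𝓡 n) (chartAt (EuclideanSpace ℝ (Fin n)) q).symm
      (transition p q y) :=
    mdifferentiableAt_chart_symm ((chartAt (EuclideanSpace ℝ (Fin n)) q).map_source hy'.2)
  have h1 := mfderiv_comp y hq hτ
  have h2 : (chartAt (EuclideanSpace ℝ (Fin n)) q).symm ∘ transition p q =ᶠ[𝓝 y]
      (chartAt (EuclideanSpace ℝ (Fin n)) p).symm := by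
    filter_upwards [(transition p q).open_source.mem_nhds hy] with z hz
    exact (chartAt (EuclideanSpace ℝ (Fin n)) q).left_inv (mem_transition_source.1 hz).2
  have h3 := h2.mfderiv_eq (I := 𝓡 n) (I' := 𝓡 n)
  rw [mfderiv_eq_fderiv] at h1
  exact h3.symm.trans h1

/-- The coordinate field is the tangent map of the inverse chart applied to a constant section.
Smoothness in this bundle form is what the smooth Riemannian bundle structure accepts. -/
theorem contMDiffOn_coordVec (p : M) (j : Fin n) :
    ContMDiffOn (𝓡 n) (𝓡 n).tangent ∞
      (fun y ↦ (⟨(chartAt (EuclideanSpace ℝ (Fin n)) p).symm y, coordVec p y j⟩ :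
        TangentBundle (𝓡 n) M)) (chartAt (EuclideanSpace ℝ (Fin n)) p).target := by
  have : IsManifold (𝓡 n) 1 M := .of_le (n := ∞) (by simp)
  have ho := (chartAt (EuclideanSpace ℝ (Fin n)) p).open_target
  have h1 := (contMDiffOn_chart_symm (I := 𝓡 n) (n := ∞) (x := p)).contMDiffOn_tangentMapWithin
    (m := ∞) le_rfl ho.uniqueMDiffOn
  have h2 : ContMDiff (𝓡 n) (𝓡 n).tangent ∞ (fun y : EuclideanSpace ℝ (Fin n) ↦
      (⟨y, EuclideanSpace.single j (1 : ℝ)⟩ : TangentBundle (𝓡 n) (EuclideanSpace ℝ (Fin n)))) :=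
    contMDiff_vectorSpace_iff_contDiff.2
      (contDiff_const (c := (EuclideanSpace.single j (1 : ℝ) : EuclideanSpace ℝ (Fin n))))
  refine (h1.comp h2.contMDiffOn fun y hy ↦ hy).congr fun y hy ↦ ?_
  simp only [Function.comp, tangentMapWithin, mfderivWithin_of_isOpen ho hy]
  rfl

end Smooth

variable [RiemannianBundle (fun x : M ↦ TangentSpace (𝓡 n) x)]

/-- The inner product of the tangent space at `x`, as a function on the model space. -/
def metric (x : M) (v w : EuclideanSpace ℝ (Fin n)) : ℝ :=
  inner ℝ (show TangentSpace (𝓡 n) x from v) (show TangentSpace (𝓡 n) x from w)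

theorem volDensity_nonneg (p : M) (y : EuclideanSpace ℝ (Fin n)) : 0 ≤ volDensity p y :=
  Real.sqrt_nonneg _

theorem gramMatrix_apply (p : M) (y : EuclideanSpace ℝ (Fin n)) (j k : Fin n) :
    gramMatrix p y j k = metric ((chartAt (EuclideanSpace ℝ (Fin n)) p).symm y)
      (frame p y (EuclideanSpace.single j 1)) (frame p y (EuclideanSpace.single k 1)) := rfl

/-- Bilinearity, phrased through `metric` because the model space already carries the Euclidean
inner product, which must not be confused with that of the tangent space. -/
theorem metric_sum_smul {ι : Type*} (s : Finset ι) (x : M)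
    (v w : ι → EuclideanSpace ℝ (Fin n)) (b c : ι → ℝ) :
    metric x (∑ i ∈ s, b i • v i) (∑ j ∈ s, c j • w j) =
      ∑ i ∈ s, ∑ j ∈ s, b i * metric x (v i) (w j) * c j := by
  have h := sum_inner (𝕜 := ℝ) (E := TangentSpace (𝓡 n) x) s (fun i ↦ b i • v i)
    (∑ j ∈ s, c j • w j)
  refine h.trans (Finset.sum_congr rfl fun i _ ↦ ?_)
  have h' := inner_sum (𝕜 := ℝ) (E := TangentSpace (𝓡 n) x) s (fun j ↦ c j • w j)
    (b i • v i)
  refine h'.trans (Finset.sum_congr rfl fun j _ ↦ ?_)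
  have h1 := real_inner_smul_left (F := TangentSpace (𝓡 n) x) (v i) (c j • w j) (b i)
  have h2 := real_inner_smul_right (F := TangentSpace (𝓡 n) x) (v i) (w j) (c j)
  refine (h1.trans (congrArg (b i * ·) h2)).trans ?_
  change b i * (c j * metric x (v i) (w j)) = _
  ring

theorem eq_sum_coord_smul (v : EuclideanSpace ℝ (Fin n)) :
    v = ∑ k, v k • EuclideanSpace.single k (1 : ℝ) := by
  ext i
  simp [Finset.sum_apply, Pi.single_apply]

/-- The matrix of an endomorphism of Euclidean space in the standard basis. -/
def stdMatrix (A : EuclideanSpace ℝ (Fin n) →L[ℝ] EuclideanSpace ℝ (Fin n)) :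
    Matrix (Fin n) (Fin n) ℝ :=
  Matrix.of fun k j ↦ A (EuclideanSpace.single j 1) k

theorem det_stdMatrix (A : EuclideanSpace ℝ (Fin n) →L[ℝ] EuclideanSpace ℝ (Fin n)) :
    (stdMatrix A).det = A.det := by
  have h := LinearMap.det_toMatrix (EuclideanSpace.basisFun (Fin n) ℝ).toBasis A.toLinearMap
  rw [ContinuousLinearMap.det, ← h]
  congr 1

variable [IsManifold (𝓡 n) ∞ M]

/-- Congruence `G_p = Jᵀ G_q J` by the Jacobian of the transition map: expand the columns of `J` in
the standard basis and use bilinearity. -/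
theorem gramMatrix_transition {p q : M} {y : EuclideanSpace ℝ (Fin n)}
    (hy : y ∈ (transition p q).source) :
    gramMatrix p y = (stdMatrix (fderiv ℝ (transition p q) y)).transpose *
      gramMatrix q (transition p q y) * stdMatrix (fderiv ℝ (transition p q) y) := by
  have hy' := mem_transition_source.1 hy
  have hx : (chartAt (EuclideanSpace ℝ (Fin n)) q).symm (transition p q y) =
      (chartAt (EuclideanSpace ℝ (Fin n)) p).symm y :=
    (chartAt (EuclideanSpace ℝ (Fin n)) q).left_inv hy'.2
  ext i j
  rw [gramMatrix_apply, frame_eq_comp_transition hy, ContinuousLinearMap.comp_apply,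
    ContinuousLinearMap.comp_apply,
    eq_sum_coord_smul (fderiv ℝ (transition p q) y (EuclideanSpace.single i 1)),
    eq_sum_coord_smul (fderiv ℝ (transition p q) y (EuclideanSpace.single j 1)),
    map_sum, map_sum]
  simp only [map_smul]
  rw [metric_sum_smul, Matrix.mul_apply]
  simp only [Matrix.mul_apply, Finset.sum_mul]
  rw [Finset.sum_comm]
  refine Finset.sum_congr rfl fun k _ ↦ Finset.sum_congr rfl fun l _ ↦ ?_
  rw [gramMatrix_apply, hx]
  rfl

/-- Determinant and square root of the congruence above. The factor `|det J|` is the one in the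
change of variables formula. -/
theorem volDensity_transition {p q : M} {y : EuclideanSpace ℝ (Fin n)}
    (hy : y ∈ (transition p q).source) :
    volDensity p y =
      |(fderiv ℝ (transition p q) y).det| * volDensity q (transition p q y) := by
  rw [volDensity, gramMatrix_transition hy, Matrix.det_mul, Matrix.det_mul,
    Matrix.det_transpose, det_stdMatrix, mul_right_comm, ← pow_two, Real.sqrt_mul (sq_nonneg _),
    Real.sqrt_sq_eq_abs, volDensity]

/-- The coordinate vectors are linearly independent, so their Gram matrix is positive definite. -/
theorem gramMatrix_det_pos {p : M} {y : EuclideanSpace ℝ (Fin n)}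
    (hy : y ∈ (chartAt (EuclideanSpace ℝ (Fin n)) p).target) :
    0 < (gramMatrix p y).det := by
  have h1 : LinearIndependent ℝ
      fun j ↦ frame p y (EuclideanSpace.single j (1 : ℝ)) := by
    have h := (EuclideanSpace.basisFun (Fin n) ℝ).toBasis.linearIndependent.map'
      (frame p y).toLinearMap (LinearMap.ker_eq_bot.2 (frame_injective hy))
    convert! h using 2
    simp
  have h2 : LinearIndependent ℝ fun j ↦ coordVec p y j := h1
  exact ((Matrix.posDef_gram_iff_linearIndependent (𝕜 := ℝ)).2 h2).det_pos

theorem volDensity_pos {p : M} {y : EuclideanSpace ℝ (Fin n)}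
    (hy : y ∈ (chartAt (EuclideanSpace ℝ (Fin n)) p).target) : 0 < volDensity p y :=
  Real.sqrt_pos.2 (gramMatrix_det_pos hy)

variable [IsContMDiffRiemannianBundle (𝓡 n) ∞ (EuclideanSpace ℝ (Fin n))
      (fun x : M ↦ TangentSpace (𝓡 n) x)]

theorem contDiffOn_gramMatrix_apply (p : M) (j k : Fin n) :
    ContDiffOn ℝ ∞ (fun y ↦ gramMatrix p y j k)
      (chartAt (EuclideanSpace ℝ (Fin n)) p).target := by
  rw [← contMDiffOn_iff_contDiffOn]
  exact (contMDiffOn_coordVec p j).inner_bundle (contMDiffOn_coordVec p k)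

theorem _root_.ContDiffOn.matrix_det {m : ℕ} {E : Type*} [NormedAddCommGroup E] [NormedSpace ℝ E]
    {r : WithTop ℕ∞} {s : Set E} {A : E → Matrix (Fin m) (Fin m) ℝ}
    (hA : ∀ i j, ContDiffOn ℝ r (fun y ↦ A y i j) s) :
    ContDiffOn ℝ r (fun y ↦ (A y).det) s := by
  simp only [Matrix.det_apply']
  exact ContDiffOn.sum fun σ _ ↦ contDiffOn_const.mul (contDiffOn_prod fun i _ ↦ hA _ _)

/-- Cramer's rule: entries of the inverse are adjugate entries, themselves determinants, over a
non-vanishing determinant. -/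
theorem contDiffOn_gramMatrix_inv_apply (p : M) (j k : Fin n) :
    ContDiffOn ℝ ∞ (fun y ↦ (gramMatrix p y)⁻¹ j k)
      (chartAt (EuclideanSpace ℝ (Fin n)) p).target := by
  simp only [Matrix.inv_def, Ring.inverse_eq_inv', Matrix.smul_apply, smul_eq_mul,
    Matrix.adjugate_apply]
  refine ((ContDiffOn.matrix_det (contDiffOn_gramMatrix_apply p)).inv
    fun y hy ↦ (gramMatrix_det_pos hy).ne').mul (ContDiffOn.matrix_det fun i l ↦ ?_)
  simp only [Matrix.updateRow_apply]
  split_ifs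
  · exact contDiffOn_const
  · exact contDiffOn_gramMatrix_apply p i l

theorem contDiffOn_volDensity (p : M) :
    ContDiffOn ℝ ∞ (volDensity p) (chartAt (EuclideanSpace ℝ (Fin n)) p).target :=
  (ContDiffOn.matrix_det (contDiffOn_gramMatrix_apply p)).sqrt
    fun _ hy ↦ (gramMatrix_det_pos hy).ne'

end Coordinates

/-! ### The partition of unity as a finite sum. -/

section Partition

variable {n : ℕ} {M : Type*} [TopologicalSpace M] [ChartedSpace (EuclideanSpace ℝ (Fin n)) M]
  [IsManifold (𝓡 n) ∞ M] [T2Space M] [CompactSpace M]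

variable (n M) in
/-- The partition of unity subordinate to the chart domains used in `riemannianVolume`. -/
def chartPartition : SmoothPartitionOfUnity M (𝓡 n) M :=
  (SmoothPartitionOfUnity.exists_isSubordinate_chartAt_source (𝓡 n) M).choose

theorem tsupport_chartPartition_subset (p : M) :
    tsupport (chartPartition n M p) ⊆ (chartAt (EuclideanSpace ℝ (Fin n)) p).source :=
  (SmoothPartitionOfUnity.exists_isSubordinate_chartAt_source (𝓡 n) M).choose_spec p

variable (n M) in
/-- The finite set of indices of the nonzero functions of `chartPartition`. -/
def chartPartitionIndices : Finset M :=
  (chartPartition n M).locallyFinite.finite_nonempty_of_compact.toFinset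

theorem chartPartition_eq_zero {p : M} (hp : p ∉ chartPartitionIndices n M) (x : M) :
    chartPartition n M p x = 0 := by
  by_contra h
  exact hp ((Set.Finite.mem_toFinset _).2 ⟨x, h⟩)

theorem sum_chartPartition (x : M) :
    ∑ p ∈ chartPartitionIndices n M, chartPartition n M p x = 1 := by
  rw [← (chartPartition n M).sum_eq_one (Set.mem_univ x)]
  refine (finsum_eq_sum_of_support_subset _ fun p hp ↦ ?_).symm
  by_contra h
  exact hp (chartPartition_eq_zero h x)

end Partition

/-! ### The Riemannian volume measure in charts. -/

section Volume

/-- The image is the part of the target that the inverse chart sends into `A`, and the inverse chart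
is continuous on the open target. -/
theorem measurableSet_chart_image {n : ℕ} {M : Type*} [TopologicalSpace M]
    [ChartedSpace (EuclideanSpace ℝ (Fin n)) M] [MeasurableSpace M] [BorelSpace M]
    {p : M} {A : Set M} (hA : MeasurableSet A)
    (hAp : A ⊆ (chartAt (EuclideanSpace ℝ (Fin n)) p).source) :
    MeasurableSet (chartAt (EuclideanSpace ℝ (Fin n)) p '' A) := by
  rw [OpenPartialHomeomorph.image_eq_target_inter_inv_preimage _ hAp]
  have h : Measurable ((chartAt (EuclideanSpace ℝ (Fin n)) p).target.domRestrict
      (chartAt (EuclideanSpace ℝ (Fin n)) p).symm) :=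
    (chartAt (EuclideanSpace ℝ (Fin n)) p).continuousOn_symm.domRestrict.measurable
  convert (chartAt (EuclideanSpace ℝ (Fin n)) p).open_target.measurableSet.subtype_image (h hA)
    using 1
  ext y
  simp [and_comm]

variable {n : ℕ} {M : Type*} [TopologicalSpace M] [ChartedSpace (EuclideanSpace ℝ (Fin n)) M]
  [RiemannianBundle (fun x : M ↦ TangentSpace (𝓡 n) x)] [MeasurableSpace M] [BorelSpace M]

theorem aemeasurable_chart_symm (p : M) :
    AEMeasurable (chartAt (EuclideanSpace ℝ (Fin n)) p).symm
      ((volume.restrict (chartAt (EuclideanSpace ℝ (Fin n)) p).target).withDensity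
        fun y ↦ ENNReal.ofReal (volDensity p y)) :=
  ((chartAt (EuclideanSpace ℝ (Fin n)) p).continuousOn_symm.aemeasurable
    (chartAt (EuclideanSpace ℝ (Fin n)) p).open_target.measurableSet).mono_ac
    (withDensity_absolutelyContinuous _ _)

theorem chartVolume_apply {p : M} {A : Set M} (hA : MeasurableSet A)
    (hAp : A ⊆ (chartAt (EuclideanSpace ℝ (Fin n)) p).source) :
    chartVolume (n := n) p A = ∫⁻ y in chartAt (EuclideanSpace ℝ (Fin n)) p '' A,
      ENNReal.ofReal (volDensity p y) := by
  rw [chartVolume, Measure.map_apply_of_aemeasurable (aemeasurable_chart_symm p) hA,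
    withDensity_apply', Measure.restrict_restrict'
      (chartAt (EuclideanSpace ℝ (Fin n)) p).open_target.measurableSet,
    OpenPartialHomeomorph.image_eq_target_inter_inv_preimage _ hAp, Set.inter_comm]

theorem chartVolume_compl_source (p : M) :
    chartVolume (n := n) p (chartAt (EuclideanSpace ℝ (Fin n)) p).sourceᶜ = 0 := by
  rw [chartVolume, Measure.map_apply_of_aemeasurable (aemeasurable_chart_symm p)
    (chartAt (EuclideanSpace ℝ (Fin n)) p).open_source.measurableSet.compl,
    withDensity_apply', Measure.restrict_restrict'
      (chartAt (EuclideanSpace ℝ (Fin n)) p).open_target.measurableSet]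
  have h : (chartAt (EuclideanSpace ℝ (Fin n)) p).symm ⁻¹'
      (chartAt (EuclideanSpace ℝ (Fin n)) p).sourceᶜ ∩
        (chartAt (EuclideanSpace ℝ (Fin n)) p).target = ∅ :=
    Set.eq_empty_of_forall_notMem fun y hy ↦
      hy.1 ((chartAt (EuclideanSpace ℝ (Fin n)) p).map_target hy.2)
  rw [h, setLIntegral_empty]

theorem chartVolume_restrict_source (p : M) :
    (chartVolume (n := n) p).restrict (chartAt (EuclideanSpace ℝ (Fin n)) p).source =
      chartVolume (n := n) p :=
  Measure.restrict_eq_self_of_ae_mem (by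
    rw [ae_iff]
    exact chartVolume_compl_source p)

variable [IsManifold (𝓡 n) ∞ M]

/-- Change of variables along the transition map; its Jacobian is absorbed by
`volDensity_transition`. -/
theorem chartVolume_eq_of_subset {p q : M} {A : Set M} (hA : MeasurableSet A)
    (hAp : A ⊆ (chartAt (EuclideanSpace ℝ (Fin n)) p).source)
    (hAq : A ⊆ (chartAt (EuclideanSpace ℝ (Fin n)) q).source) :
    chartVolume (n := n) p A = chartVolume (n := n) q A := by
  have hsub : chartAt (EuclideanSpace ℝ (Fin n)) p '' A ⊆ (transition p q).source := by
    rintro _ ⟨x, hx, rfl⟩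
    rw [mem_transition_source,
      (chartAt (EuclideanSpace ℝ (Fin n)) p).left_inv (hAp hx)]
    exact ⟨(chartAt (EuclideanSpace ℝ (Fin n)) p).map_source (hAp hx), hAq hx⟩
  have himage : chartAt (EuclideanSpace ℝ (Fin n)) q '' A =
      transition p q '' (chartAt (EuclideanSpace ℝ (Fin n)) p '' A) := by
    rw [Set.image_image]
    refine Set.image_congr fun x hx ↦ ?_
    rw [transition_apply, (chartAt (EuclideanSpace ℝ (Fin n)) p).left_inv (hAp hx)]
  rw [chartVolume_apply hA hAp, chartVolume_apply hA hAq, himage,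
    lintegral_image_eq_lintegral_abs_det_fderiv_mul volume (measurableSet_chart_image hA hAp)
      (fun y hy ↦ (hasFDerivAt_transition (hsub hy)).hasFDerivWithinAt)
      ((transition p q).injOn.mono hsub)]
  refine setLIntegral_congr_fun (measurableSet_chart_image hA hAp) fun y hy ↦ ?_
  rw [← ENNReal.ofReal_mul (abs_nonneg _), ← volDensity_transition (hsub hy)]

theorem chartVolume_restrict_comm (p q : M) :
    (chartVolume (n := n) p).restrict (chartAt (EuclideanSpace ℝ (Fin n)) q).source =
      (chartVolume (n := n) q).restrict (chartAt (EuclideanSpace ℝ (Fin n)) p).source := by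
  have hp := (chartAt (EuclideanSpace ℝ (Fin n)) p).open_source.measurableSet
  have hq := (chartAt (EuclideanSpace ℝ (Fin n)) q).open_source.measurableSet
  rw [← chartVolume_restrict_source p, ← chartVolume_restrict_source q,
    Measure.restrict_restrict hp, Measure.restrict_restrict hq, Set.inter_comm]
  ext A hA
  rw [Measure.restrict_apply hA, Measure.restrict_apply hA]
  exact chartVolume_eq_of_subset (hA.inter (hp.inter hq)) (fun x hx ↦ hx.2.1) fun x hx ↦ hx.2.2

variable [T2Space M] [CompactSpace M]

/-- Chart volumes agree on overlaps and the weights of the partition add up to one, so the choice of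
partition disappears on each chart domain. -/
theorem riemannianVolume_restrict_source (q : M) :
    (riemannianVolume n M).restrict (chartAt (EuclideanSpace ℝ (Fin n)) q).source =
      chartVolume (n := n) q := by
  have hq := (chartAt (EuclideanSpace ℝ (Fin n)) q).open_source.measurableSet
  -- The weight at `p` vanishes off the chart domain of `p`, so both integrals only see the overlap,
  -- where the two chart volumes coincide.
  have key (p : M) (A : Set M) (hA : MeasurableSet A)
      (hAq : A ⊆ (chartAt (EuclideanSpace ℝ (Fin n)) q).source) :
      ∫⁻ x in A, ENNReal.ofReal (chartPartition n M p x) ∂(chartVolume (n := n) p) =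
        ∫⁻ x in A, ENNReal.ofReal (chartPartition n M p x) ∂(chartVolume (n := n) q) := by
    have hp := (chartAt (EuclideanSpace ℝ (Fin n)) p).open_source.measurableSet
    have h0 (μ : Measure M) :
        ∫⁻ x in A, ENNReal.ofReal (chartPartition n M p x) ∂μ =
          ∫⁻ x in A ∩ (chartAt (EuclideanSpace ℝ (Fin n)) p).source,
            ENNReal.ofReal (chartPartition n M p x) ∂μ := by
      rw [← lintegral_inter_add_sdiff _ A hp, setLIntegral_congr_fun (hA.diff hp)
        (g := fun _ ↦ 0) fun x hx ↦ ?_, lintegral_zero, add_zero]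
      rw [image_eq_zero_of_notMem_tsupport fun h ↦ hx.2 (tsupport_chartPartition_subset p h),
        ENNReal.ofReal_zero]
    have h1 : A ∩ (chartAt (EuclideanSpace ℝ (Fin n)) p).source =
        A ∩ ((chartAt (EuclideanSpace ℝ (Fin n)) q).source ∩
          (chartAt (EuclideanSpace ℝ (Fin n)) p).source) := by
      rw [← Set.inter_assoc, Set.inter_eq_left.2 hAq]
    rw [h0, h0, h1, ← Measure.restrict_restrict hA, ← Measure.restrict_restrict hA]
    congr 2
    rw [← Measure.restrict_restrict hq, chartVolume_restrict_source,
      Set.inter_comm, ← Measure.restrict_restrict hp, chartVolume_restrict_source,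
      chartVolume_restrict_comm]
  ext A hA
  rw [Measure.restrict_apply hA, riemannianVolume, Measure.sum_apply _ (hA.inter hq)]
  have hB := hA.inter hq
  calc _ = ∑' p : M, ∫⁻ x in A ∩ (chartAt (EuclideanSpace ℝ (Fin n)) q).source,
        ENNReal.ofReal (chartPartition n M p x) ∂(chartVolume (n := n) q) := by
        refine tsum_congr fun p ↦ ?_
        rw [withDensity_apply _ hB]
        exact key p _ hB Set.inter_subset_right
    _ = ∑ p ∈ chartPartitionIndices n M,
        ∫⁻ x in A ∩ (chartAt (EuclideanSpace ℝ (Fin n)) q).source,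
        ENNReal.ofReal (chartPartition n M p x) ∂(chartVolume (n := n) q) := by
        refine tsum_eq_sum fun p hp ↦ ?_
        simp [chartPartition_eq_zero hp]
    _ = ∫⁻ x in A ∩ (chartAt (EuclideanSpace ℝ (Fin n)) q).source, 1
          ∂(chartVolume (n := n) q) := by
        rw [← lintegral_finsetSum _ fun p _ ↦
          ((chartPartition n M p).contMDiff.continuous.measurable.ennreal_ofReal)]
        refine lintegral_congr fun x ↦ ?_
        rw [← ENNReal.ofReal_sum_of_nonneg fun p _ ↦ (chartPartition n M).nonneg p x,
          sum_chartPartition, ENNReal.ofReal_one]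
    _ = _ := by
        rw [setLIntegral_one, ← Measure.restrict_apply hA, chartVolume_restrict_source]

variable [IsContMDiffRiemannianBundle (𝓡 n) ∞ (EuclideanSpace ℝ (Fin n))
      (fun x : M ↦ TangentSpace (𝓡 n) x)]

/-- The density is continuous, hence integrable on compact neighbourhoods inside a chart;
compactness of `M` does the rest. -/
instance isFiniteMeasure_riemannianVolume : IsFiniteMeasure (riemannianVolume n M) := by
  have : IsLocallyFiniteMeasure (riemannianVolume n M) := by
    refine ⟨fun x ↦ ?_⟩
    obtain ⟨K, hK, hKx, hKc⟩ := local_compact_nhds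
      ((chartAt (EuclideanSpace ℝ (Fin n)) x).open_source.mem_nhds
        (mem_chart_source (EuclideanSpace ℝ (Fin n)) x))
    refine ⟨K, hK, ?_⟩
    rw [← Measure.restrict_eq_self _ hKx, riemannianVolume_restrict_source,
      chartVolume_apply hKc.measurableSet hKx]
    refine (ContinuousOn.integrableOn_compact (hKc.image_of_continuousOn
      ((chartAt (EuclideanSpace ℝ (Fin n)) x).continuousOn.mono hKx))
      ((contDiffOn_volDensity x).continuousOn.mono ?_)).setLIntegral_lt_top
    rintro _ ⟨y, hy, rfl⟩
    exact (chartAt (EuclideanSpace ℝ (Fin n)) x).map_source (hKx hy)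
  infer_instance

/-- The density is strictly positive. This lets equalities almost everywhere between continuous
functions be upgraded to equalities everywhere. -/
instance isOpenPosMeasure_riemannianVolume :
    (riemannianVolume n M).IsOpenPosMeasure := by
  refine ⟨fun U hU hne h0 ↦ ?_⟩
  obtain ⟨x, hx⟩ := hne
  set e := chartAt (EuclideanSpace ℝ (Fin n)) x
  have hVo : IsOpen (U ∩ e.source) := hU.inter e.open_source
  have h1 : riemannianVolume n M (U ∩ e.source) = 0 := measure_mono_null Set.inter_subset_left h0
  rw [← Measure.restrict_eq_self _ Set.inter_subset_right, riemannianVolume_restrict_source,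
    chartVolume_apply hVo.measurableSet Set.inter_subset_right] at h1
  have himo : IsOpen (e '' (U ∩ e.source)) :=
    e.isOpen_image_of_subset_source hVo Set.inter_subset_right
  have hmaps : e '' (U ∩ e.source) ⊆ e.target := by
    rintro _ ⟨y, hy, rfl⟩
    exact e.map_source hy.2
  rw [lintegral_eq_zero_iff' (((contDiffOn_volDensity x).continuousOn.mono hmaps).aemeasurable
    himo.measurableSet).ennreal_ofReal, EventuallyEq,
    ae_restrict_iff' himo.measurableSet] at h1
  have h2 : volume (e '' (U ∩ e.source)) = 0 := by
    refine measure_mono_null (fun y hy ↦ ?_) h1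
    intro h
    have := h hy
    simp only [Pi.zero_apply, ENNReal.ofReal_eq_zero] at this
    exact (volDensity_pos (hmaps hy)).not_ge this
  exact himo.measure_ne_zero volume
    ⟨e x, x, ⟨hx, mem_chart_source (EuclideanSpace ℝ (Fin n)) x⟩, rfl⟩ h2

theorem integral_riemannianVolume_of_continuousOn {q : M} {f : M → ℝ}
    (hf : ContinuousOn f (chartAt (EuclideanSpace ℝ (Fin n)) q).source)
    (hfq : ∀ x ∉ (chartAt (EuclideanSpace ℝ (Fin n)) q).source, f x = 0) :
    ∫ x, f x ∂(riemannianVolume n M) =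
      ∫ y in (chartAt (EuclideanSpace ℝ (Fin n)) q).target,
        volDensity q y * f ((chartAt (EuclideanSpace ℝ (Fin n)) q).symm y) := by
  have hq := (chartAt (EuclideanSpace ℝ (Fin n)) q).open_source.measurableSet
  have hm : AEStronglyMeasurable f (chartVolume (n := n) q) := by
    rw [← chartVolume_restrict_source]
    exact hf.aestronglyMeasurable hq
  rw [← setIntegral_eq_integral_of_forall_compl_eq_zero hfq, riemannianVolume_restrict_source]
  rw [chartVolume] at hm ⊢
  rw [integral_map (aemeasurable_chart_symm q) hm, integral_withDensity_eq_integral_toReal_smul₀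
    (((contDiffOn_volDensity q).continuousOn.aemeasurable
      (chartAt (EuclideanSpace ℝ (Fin n)) q).open_target.measurableSet).ennreal_ofReal)
    (ae_of_all _ fun _ ↦ ENNReal.ofReal_lt_top)]
  refine integral_congr_ae (ae_of_all _ fun y ↦ ?_)
  simp only [smul_eq_mul]
  rw [ENNReal.toReal_ofReal (volDensity_nonneg q y)]

end Volume

/-! ### Directional derivatives and the gradient in coordinates. -/

section Gradient

variable {n : ℕ} {M : Type*} [TopologicalSpace M] [ChartedSpace (EuclideanSpace ℝ (Fin n)) M]

/-- The derivative of `φ` along the vector field `X`. -/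
def dirDeriv (φ : M → ℝ) (X : ∀ x : M, TangentSpace (𝓡 n) x) (x : M) : ℝ :=
  mfderiv (𝓡 n) 𝓘(ℝ, ℝ) φ x (X x)

/-- A vector field is `C¹` if its components in all charts are. -/
def IsC1VectorField (X : ∀ x : M, TangentSpace (𝓡 n) x) : Prop :=
  ∀ (p : M) (j : Fin n),
    ContDiffOn ℝ 1 (vecComponent X p j) (chartAt (EuclideanSpace ℝ (Fin n)) p).target

theorem vecComponent_apply (X : ∀ x : M, TangentSpace (𝓡 n) x) (p : M) (j : Fin n)
    (y : EuclideanSpace ℝ (Fin n)) :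
    vecComponent X p j y = coframe p ((chartAt (EuclideanSpace ℝ (Fin n)) p).symm y)
      (X ((chartAt (EuclideanSpace ℝ (Fin n)) p).symm y)) j := rfl

/-- The function `φ` in the chart centred at `p`. -/
def inChart (p : M) (φ : M → ℝ) (y : EuclideanSpace ℝ (Fin n)) : ℝ :=
  φ ((chartAt (EuclideanSpace ℝ (Fin n)) p).symm y)

/-- The `j`-th partial derivative of `φ` in the chart centred at `p`. -/
def partialDeriv (p : M) (φ : M → ℝ) (j : Fin n) (y : EuclideanSpace ℝ (Fin n)) : ℝ :=
  fderiv ℝ (inChart p φ) y (EuclideanSpace.single j (1 : ℝ))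

theorem vecComponent_smul (a : M → ℝ) (X : ∀ x : M, TangentSpace (𝓡 n) x) (p : M) (j : Fin n)
    (y : EuclideanSpace ℝ (Fin n)) :
    vecComponent (fun x ↦ a x • X x) p j y = inChart p a y * vecComponent X p j y := by
  have h := (coframe p ((chartAt (EuclideanSpace ℝ (Fin n)) p).symm y)).map_smul
    (inChart p a y) (X ((chartAt (EuclideanSpace ℝ (Fin n)) p).symm y))
  exact congrArg (fun v : EuclideanSpace ℝ (Fin n) ↦ v j) h

variable [IsManifold (𝓡 n) ∞ M]

theorem two_le_smooth : (2 : WithTop ℕ∞) ≤ (∞ : WithTop ℕ∞) :=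
  WithTop.coe_le_coe.2 (le_top : (2 : ℕ∞) ≤ ⊤)

theorem contDiffOn_inChart {r : WithTop ℕ∞} (hr : r ≤ (∞ : WithTop ℕ∞)) (p : M) {φ : M → ℝ}
    (hφ : ContMDiff (𝓡 n) 𝓘(ℝ, ℝ) r φ) :
    ContDiffOn ℝ r (inChart p φ) (chartAt (EuclideanSpace ℝ (Fin n)) p).target := by
  have : IsManifold (𝓡 n) r M := .of_le hr
  rw [← contMDiffOn_iff_contDiffOn]
  exact hφ.comp_contMDiffOn (contMDiffOn_chart_symm (I := 𝓡 n) (n := r) (x := p))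

theorem contDiffOn_partialDeriv {r s : WithTop ℕ∞} (hr : r ≤ (∞ : WithTop ℕ∞)) (hs : s + 1 ≤ r) (p : M)
    {φ : M → ℝ} (hφ : ContMDiff (𝓡 n) 𝓘(ℝ, ℝ) r φ) (j : Fin n) :
    ContDiffOn ℝ s (partialDeriv p φ j) (chartAt (EuclideanSpace ℝ (Fin n)) p).target :=
  ((contDiffOn_inChart hr p hφ).fderiv_of_isOpen
    (chartAt (EuclideanSpace ℝ (Fin n)) p).open_target hs).clm_apply contDiffOn_const

theorem IsC1VectorField.smul {a : M → ℝ} (ha : ContMDiff (𝓡 n) 𝓘(ℝ, ℝ) 1 a)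
    {X : ∀ x : M, TangentSpace (𝓡 n) x} (hX : IsC1VectorField X) :
    IsC1VectorField (fun x ↦ a x • X x) := fun p j ↦
  ((contDiffOn_inChart (by simp) p ha).mul (hX p j)).congr
    fun y _ ↦ vecComponent_smul a X p j y

theorem fderiv_inChart_eq {p : M} {y : EuclideanSpace ℝ (Fin n)}
    (hy : y ∈ (chartAt (EuclideanSpace ℝ (Fin n)) p).target) {φ : M → ℝ}
    (hφ : MDifferentiable (𝓡 n) 𝓘(ℝ, ℝ) φ) (v : EuclideanSpace ℝ (Fin n)) :
    fderiv ℝ (inChart p φ) y v = dirDeriv φ (fun _ ↦ frame p y v)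
      ((chartAt (EuclideanSpace ℝ (Fin n)) p).symm y) := by
  have h := mfderiv_comp (I := 𝓡 n) (I' := 𝓡 n) (I'' := 𝓘(ℝ, ℝ)) y
    (hφ ((chartAt (EuclideanSpace ℝ (Fin n)) p).symm y)) (mdifferentiableAt_chart_symm hy)
  have h' := mfderiv_eq_fderiv (𝕜 := ℝ) (f := inChart p φ) (x := y)
  exact DFunLike.congr_fun (h'.symm.trans h) v

theorem dirDeriv_eq_fderiv {p x : M} (hx : x ∈ (chartAt (EuclideanSpace ℝ (Fin n)) p).source)
    {φ : M → ℝ} (hφ : MDifferentiable (𝓡 n) 𝓘(ℝ, ℝ) φ)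
    (X : ∀ x : M, TangentSpace (𝓡 n) x) :
    dirDeriv φ X x = fderiv ℝ (inChart p φ) (chartAt (EuclideanSpace ℝ (Fin n)) p x)
      (coframe p x (X x)) := by
  have h := fderiv_inChart_eq ((chartAt (EuclideanSpace ℝ (Fin n)) p).map_source hx) hφ
    (coframe p x (X x))
  have h2 : frame p (chartAt (EuclideanSpace ℝ (Fin n)) p x) (coframe p x (X x)) = X x :=
    DFunLike.congr_fun (frame_comp_coframe hx) (X x)
  rw [h2, (chartAt (EuclideanSpace ℝ (Fin n)) p).left_inv hx] at h
  exact h.symm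

theorem dirDeriv_eq_sum {p x : M} (hx : x ∈ (chartAt (EuclideanSpace ℝ (Fin n)) p).source)
    {φ : M → ℝ} (hφ : MDifferentiable (𝓡 n) 𝓘(ℝ, ℝ) φ)
    (X : ∀ x : M, TangentSpace (𝓡 n) x) :
    dirDeriv φ X x = ∑ j, partialDeriv p φ j (chartAt (EuclideanSpace ℝ (Fin n)) p x) *
      vecComponent X p j (chartAt (EuclideanSpace ℝ (Fin n)) p x) := by
  rw [dirDeriv_eq_fderiv hx hφ, eq_sum_coord_smul (coframe p x (X x)), map_sum]
  refine Finset.sum_congr rfl fun j _ ↦ ?_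
  rw [map_smul, vecComponent_apply, (chartAt (EuclideanSpace ℝ (Fin n)) p).left_inv hx,
    smul_eq_mul, mul_comm]
  rfl

theorem differentiableAt_inChart {p : M} {y : EuclideanSpace ℝ (Fin n)}
    (hy : y ∈ (chartAt (EuclideanSpace ℝ (Fin n)) p).target) {φ : M → ℝ}
    (hφ : MDifferentiable (𝓡 n) 𝓘(ℝ, ℝ) φ) : DifferentiableAt ℝ (inChart p φ) y :=
  mdifferentiableAt_iff_differentiableAt.1
    ((hφ _).comp y (mdifferentiableAt_chart_symm hy))

theorem dirDeriv_sum {ι : Type*} {s : Finset ι} {φ : ι → M → ℝ}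
    (hφ : ∀ i, MDifferentiable (𝓡 n) 𝓘(ℝ, ℝ) (φ i))
    (hs : MDifferentiable (𝓡 n) 𝓘(ℝ, ℝ) (fun x ↦ ∑ i ∈ s, φ i x))
    (X : ∀ x : M, TangentSpace (𝓡 n) x) (x : M) :
    dirDeriv (fun x ↦ ∑ i ∈ s, φ i x) X x = ∑ i ∈ s, dirDeriv (φ i) X x := by
  have hx := mem_chart_source (EuclideanSpace ℝ (Fin n)) x
  have hy := (chartAt (EuclideanSpace ℝ (Fin n)) x).map_source hx
  have h : inChart (n := n) x (fun x ↦ ∑ i ∈ s, φ i x) =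
      fun y ↦ ∑ i ∈ s, inChart x (φ i) y := rfl
  rw [dirDeriv_eq_fderiv hx hs, h, fderiv_fun_sum fun i _ ↦ differentiableAt_inChart hy (hφ i),
    sum_apply]
  exact Finset.sum_congr rfl fun i _ ↦ (dirDeriv_eq_fderiv hx (hφ i) X).symm

theorem dirDeriv_mul {φ ψ : M → ℝ}
    (hφ : MDifferentiable (𝓡 n) 𝓘(ℝ, ℝ) φ) (hψ : MDifferentiable (𝓡 n) 𝓘(ℝ, ℝ) ψ)
    (hm : MDifferentiable (𝓡 n) 𝓘(ℝ, ℝ) (fun x ↦ φ x * ψ x))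
    (X : ∀ x : M, TangentSpace (𝓡 n) x) (x : M) :
    dirDeriv (fun x ↦ φ x * ψ x) X x = φ x * dirDeriv ψ X x + ψ x * dirDeriv φ X x := by
  have hx := mem_chart_source (EuclideanSpace ℝ (Fin n)) x
  have hy := (chartAt (EuclideanSpace ℝ (Fin n)) x).map_source hx
  have h : inChart (n := n) x (fun x ↦ φ x * ψ x) =
      fun y ↦ inChart x φ y * inChart x ψ y := rfl
  rw [dirDeriv_eq_fderiv hx hm, dirDeriv_eq_fderiv hx hφ, dirDeriv_eq_fderiv hx hψ, h,
    fderiv_fun_mul (differentiableAt_inChart hy hφ) (differentiableAt_inChart hy hψ)]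
  simp [inChart, (chartAt (EuclideanSpace ℝ (Fin n)) x).left_inv hx]

theorem continuous_dirDeriv {φ : M → ℝ} (hφ : ContMDiff (𝓡 n) 𝓘(ℝ, ℝ) 1 φ)
    {X : ∀ x : M, TangentSpace (𝓡 n) x} (hX : IsC1VectorField X) :
    Continuous (dirDeriv φ X) := by
  rw [continuous_iff_continuousAt]
  intro p
  have hp := (chartAt (EuclideanSpace ℝ (Fin n)) p).open_source.mem_nhds
    (mem_chart_source (EuclideanSpace ℝ (Fin n)) p)
  refine ContinuousOn.continuousAt (s := (chartAt (EuclideanSpace ℝ (Fin n)) p).source) ?_ hp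
  refine ContinuousOn.congr (f := fun x ↦ ∑ j,
    partialDeriv p φ j (chartAt (EuclideanSpace ℝ (Fin n)) p x) *
      vecComponent X p j (chartAt (EuclideanSpace ℝ (Fin n)) p x)) ?_
    fun x hx ↦ dirDeriv_eq_sum hx (hφ.mdifferentiable one_ne_zero) X
  have hmaps := (chartAt (EuclideanSpace ℝ (Fin n)) p).mapsTo
  have hcont := (chartAt (EuclideanSpace ℝ (Fin n)) p).continuousOn
  exact continuousOn_finsetSum _ fun j _ ↦
    ((contDiffOn_partialDeriv (s := 0) (by simp) (by simp) p hφ j).continuousOn.comp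
      hcont hmaps).mul ((hX p j).continuousOn.comp hcont hmaps)

/-- Variant for smooth sections of the tangent bundle, the test fields in the measurability clause
of `HasSobolevGradient`. -/
theorem continuous_dirDeriv_of_contMDiff {φ : M → ℝ} (hφ : ContMDiff (𝓡 n) 𝓘(ℝ, ℝ) 1 φ)
    {X : ∀ x : M, TangentSpace (𝓡 n) x}
    (hX : ContMDiff (𝓡 n) (𝓡 n).tangent ∞ (fun x ↦ (⟨x, X x⟩ : TangentBundle (𝓡 n) M))) :
    Continuous (dirDeriv φ X) := by
  have : IsManifold (𝓡 n) 1 M := .of_le (n := ∞) (by simp)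
  exact (contMDiff_snd_tangentBundle_modelSpace (n := 0) ℝ 𝓘(ℝ, ℝ)).continuous.comp
    ((hφ.continuous_tangentMap le_rfl).comp hX.continuous)

variable [RiemannianBundle (fun x : M ↦ TangentSpace (𝓡 n) x)]

omit [IsManifold (𝓡 n) ∞ M] in
theorem inner_grad_left (u : M → ℝ) (X : ∀ x : M, TangentSpace (𝓡 n) x) (x : M) :
    inner ℝ (grad u x) (X x) = dirDeriv u X x := by
  have : FiniteDimensional ℝ (TangentSpace (𝓡 n) x) :=
    inferInstanceAs (FiniteDimensional ℝ (EuclideanSpace ℝ (Fin n)))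
  have : CompleteSpace (TangentSpace (𝓡 n) x) := FiniteDimensional.complete ℝ _
  exact InnerProductSpace.toDual_symm_apply

/-- Pairing the gradient with the coordinate vectors gives the linear system `∑ᵢ Xⁱ gᵢₖ = ∂ₖu`,
which is solved with the inverse Gram matrix. -/
theorem vecComponent_grad {p : M} {y : EuclideanSpace ℝ (Fin n)}
    (hy : y ∈ (chartAt (EuclideanSpace ℝ (Fin n)) p).target) {u : M → ℝ}
    (hu : MDifferentiable (𝓡 n) 𝓘(ℝ, ℝ) u) (j : Fin n) :
    vecComponent (grad u) p j y = ∑ k, partialDeriv p u k y * (gramMatrix p y)⁻¹ k j := by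
  set x := (chartAt (EuclideanSpace ℝ (Fin n)) p).symm y with hx
  have hxs : x ∈ (chartAt (EuclideanSpace ℝ (Fin n)) p).source :=
    (chartAt (EuclideanSpace ℝ (Fin n)) p).map_target hy
  have hyx : chartAt (EuclideanSpace ℝ (Fin n)) p x = y :=
    (chartAt (EuclideanSpace ℝ (Fin n)) p).right_inv hy
  have hv : frame p y (coframe p x (grad u x)) = grad u x := by
    have := DFunLike.congr_fun (frame_comp_coframe hxs) (grad u x)
    rwa [hyx] at this
  have h (k : Fin n) : ∑ i, vecComponent (grad u) p i y * gramMatrix p y i k =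
      partialDeriv p u k y := by
    have h1 := (inner_grad_left u (fun _ ↦ frame p y (EuclideanSpace.single k 1)) x).trans
      (fderiv_inChart_eq hy hu _).symm
    refine Eq.trans ?_ h1
    change _ = metric x (grad u x) (frame p y (EuclideanSpace.single k 1))
    rw [← hv, eq_sum_coord_smul (coframe p x (grad u x)), map_sum]
    simp only [map_smul]
    -- The bilinear expansion takes sums in both slots; Kronecker weights collapse the second one to
    -- the single vector `k`.
    have h2 := metric_sum_smul Finset.univ x
      (fun i ↦ frame p y (EuclideanSpace.single i 1))
      (fun _ : Fin n ↦ frame p y (EuclideanSpace.single k 1)) (coframe p x (grad u x))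
      (fun i ↦ if i = k then 1 else 0)
    simp only [ite_smul, one_smul, zero_smul, Finset.sum_ite_eq', Finset.mem_univ, if_true,
      mul_ite, mul_one, mul_zero] at h2
    exact h2.symm
  have h' : Matrix.vecMul (fun i ↦ vecComponent (grad u) p i y) (gramMatrix p y) =
      fun k ↦ partialDeriv p u k y := funext h
  have h3 : Matrix.vecMul (fun k ↦ partialDeriv p u k y) (gramMatrix p y)⁻¹ =
      fun i ↦ vecComponent (grad u) p i y := by
    rw [← h', Matrix.vecMul_vecMul, Matrix.mul_nonsing_inv _
      (gramMatrix_det_pos hy).ne'.isUnit, Matrix.vecMul_one]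
  exact (congrFun h3 j).symm

variable [IsContMDiffRiemannianBundle (𝓡 n) ∞ (EuclideanSpace ℝ (Fin n))
      (fun x : M ↦ TangentSpace (𝓡 n) x)]

/-- One derivative of the `C²` function is spent; the inverse metric is smooth. -/
theorem isC1VectorField_grad {u : M → ℝ} (hu : ContMDiff (𝓡 n) 𝓘(ℝ, ℝ) 2 u) :
    IsC1VectorField (n := n) (grad u) := by
  intro p j
  refine ContDiffOn.congr (f := fun y ↦ ∑ k, partialDeriv p u k y * (gramMatrix p y)⁻¹ k j) ?_
    fun y hy ↦ vecComponent_grad hy (hu.mdifferentiable two_ne_zero) j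
  exact ContDiffOn.sum fun k _ ↦ (contDiffOn_partialDeriv two_le_smooth (by norm_num) p hu k).mul
    ((contDiffOn_gramMatrix_inv_apply p k j).of_le (by simp))

end Gradient

/-! ### Integration by parts in Euclidean space. -/

section Euclidean

variable {E : Type*} [NormedAddCommGroup E] [NormedSpace ℝ E] [FiniteDimensional ℝ E]
  [MeasurableSpace E] [BorelSpace E]

/-- Integrate by parts against the constant function `1`. -/
theorem integral_fderiv_apply_eq_zero (μ : Measure E) [μ.IsAddHaarMeasure] {G : E → ℝ}
    (hG : ContDiff ℝ 1 G) (hGc : HasCompactSupport G) (v : E) :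
    ∫ y, fderiv ℝ G y v ∂μ = 0 := by
  have hd : Continuous fun y ↦ fderiv ℝ G y v :=
    (hG.continuous_fderiv one_ne_zero).clm_apply continuous_const
  have h := integral_mul_fderiv_eq_neg_fderiv_mul_of_integrable (μ := μ) (f := fun _ ↦ (1 : ℝ))
    (g := G) (v := v) (by simp)
    (by simpa using hd.integrable_of_hasCompactSupport (hGc.fderiv_apply (𝕜 := ℝ) v))
    (by simpa using hG.continuous.integrable_of_hasCompactSupport hGc)
    (fun _ _ ↦ differentiableAt_const _) (fun y _ ↦ hG.differentiable one_ne_zero y)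
  simpa using h

/-- Integration by parts on an open set, for a factor `f` that vanishes outside a compact subset. -/
theorem integral_fderiv_mul_eq_zero (μ : Measure E) [μ.IsAddHaarMeasure] {U K : Set E}
    (hU : IsOpen U) (hK : IsCompact K) (hKU : K ⊆ U) {f F : E → ℝ} (hf : ContDiffOn ℝ 1 f U)
    (hF : ContDiffOn ℝ 1 F U) (h0 : ∀ y ∈ U \ K, f y = 0) (v : E) :
    IntegrableOn (fun y ↦ f y * fderiv ℝ F y v + fderiv ℝ f y v * F y) U μ ∧
      ∫ y in U, (f y * fderiv ℝ F y v + fderiv ℝ f y v * F y) ∂μ = 0 := by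
  -- Extension by zero: `f` vanishes on `U` outside the compact `K`, so `G` is `C¹` on the whole
  -- space and compactly supported, although `F` is controlled only on `U`.
  set G : E → ℝ := U.indicator fun y ↦ f y * F y with hG
  have hGK : ∀ y ∉ K, G y = 0 := fun y hy ↦ by
    by_cases hyU : y ∈ U
    · simp [hG, hyU, h0 y ⟨hyU, hy⟩]
    · simp [hG, hyU]
  have hGU : ∀ y ∈ U, G =ᶠ[𝓝 y] fun y ↦ f y * F y := fun y hy ↦ by
    filter_upwards [hU.mem_nhds hy] with z hz using Set.indicator_of_mem hz _
  have hGKc : ∀ y ∉ K, G =ᶠ[𝓝 y] fun _ ↦ 0 := fun y hy ↦ by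
    filter_upwards [hK.isClosed.isOpen_compl.mem_nhds hy] with z hz using hGK z hz
  have hG1 : ContDiff ℝ 1 G := contDiff_iff_contDiffAt.2 fun y ↦ by
    by_cases hy : y ∈ U
    · exact ((hf.mul hF).contDiffAt (hU.mem_nhds hy)).congr_of_eventuallyEq (hGU y hy)
    · exact contDiffAt_const.congr_of_eventuallyEq (hGKc y fun h ↦ hy (hKU h))
  have hGc : HasCompactSupport G := HasCompactSupport.intro hK hGK
  have hd : (fun y ↦ fderiv ℝ G y v) =
      U.indicator fun y ↦ f y * fderiv ℝ F y v + fderiv ℝ f y v * F y := by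
    ext y
    by_cases hy : y ∈ U
    · have hy' := hU.mem_nhds hy
      rw [Set.indicator_of_mem hy, (hGU y hy).fderiv_eq, fderiv_fun_mul
        ((hf.contDiffAt hy').differentiableAt one_ne_zero)
        ((hF.contDiffAt hy').differentiableAt one_ne_zero)]
      simp [mul_comm]
    · rw [Set.indicator_of_notMem hy, (hGKc y fun h ↦ hy (hKU h)).fderiv_eq]
      simp
  have hdc : Continuous fun y ↦ fderiv ℝ G y v :=
    (hG1.continuous_fderiv one_ne_zero).clm_apply continuous_const
  constructor
  · rw [← integrable_indicator_iff hU.measurableSet, ← hd]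
    exact hdc.integrable_of_hasCompactSupport (hGc.fderiv_apply (𝕜 := ℝ) v)
  · rw [← integral_indicator hU.measurableSet, ← hd]
    exact integral_fderiv_apply_eq_zero μ hG1 hGc v

end Euclidean

/-! ### Chart independence of the divergence and the divergence theorem. -/

section Divergence

variable {n : ℕ} {M : Type*} [TopologicalSpace M] [ChartedSpace (EuclideanSpace ℝ (Fin n)) M]
  [RiemannianBundle (fun x : M ↦ TangentSpace (𝓡 n) x)]

/-- The divergence of a vector field computed in the chart centred at `q`. -/
def chartDivergence (q : M) (X : ∀ x : M, TangentSpace (𝓡 n) x) (x : M) : ℝ :=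
  (volDensity q (chartAt (EuclideanSpace ℝ (Fin n)) q x))⁻¹ *
    ∑ j : Fin n, fderiv ℝ (fun y ↦ volDensity q y * vecComponent X q j y)
      (chartAt (EuclideanSpace ℝ (Fin n)) q x) (EuclideanSpace.single j (1 : ℝ))

variable [IsManifold (𝓡 n) ∞ M]
  [IsContMDiffRiemannianBundle (𝓡 n) ∞ (EuclideanSpace ℝ (Fin n))
    (fun x : M ↦ TangentSpace (𝓡 n) x)]

theorem continuousOn_chartDivergence (q : M) {X : ∀ x : M, TangentSpace (𝓡 n) x}
    (hX : IsC1VectorField X) :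
    ContinuousOn (chartDivergence q X) (chartAt (EuclideanSpace ℝ (Fin n)) q).source := by
  have hmaps := (chartAt (EuclideanSpace ℝ (Fin n)) q).mapsTo
  have hcont := (chartAt (EuclideanSpace ℝ (Fin n)) q).continuousOn
  have ho := (chartAt (EuclideanSpace ℝ (Fin n)) q).open_target
  refine ContinuousOn.mul ?_ (continuousOn_finsetSum _ fun j _ ↦ ?_)
  · exact ((contDiffOn_volDensity q).continuousOn.comp hcont hmaps).inv₀
      fun x hx ↦ (volDensity_pos (hmaps hx)).ne'
  · have h : ContDiffOn ℝ 1 (fun y ↦ volDensity q y * vecComponent X q j y)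
        (chartAt (EuclideanSpace ℝ (Fin n)) q).target :=
      ((contDiffOn_volDensity q).of_le (by simp)).mul (hX q j)
    exact ((h.continuousOn_fderiv_of_isOpen ho le_rfl).clm_apply
      continuousOn_const).comp hcont hmaps

variable [T2Space M] [CompactSpace M] [MeasurableSpace M] [BorelSpace M]

theorem _root_.Continuous.integrable_riemannianVolume {f : M → ℝ} (hf : Continuous f) :
    Integrable f (riemannianVolume n M) :=
  hf.integrable_of_hasCompactSupport (HasCompactSupport.of_compactSpace f)

/-- In coordinates the volume density cancels the inverse density in the divergence. Together with
the derivative of `φ` along `X`, what is left is a sum of partial derivatives of compactly supported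
functions. -/
theorem integral_mul_chartDivergence {q : M} {X : ∀ x : M, TangentSpace (𝓡 n) x}
    (hX : IsC1VectorField X) {φ : M → ℝ} (hφ : ContMDiff (𝓡 n) 𝓘(ℝ, ℝ) 1 φ)
    (hφq : tsupport φ ⊆ (chartAt (EuclideanSpace ℝ (Fin n)) q).source) :
    Integrable (fun x ↦ φ x * chartDivergence q X x) (riemannianVolume n M) ∧
    ∫ x, φ x * chartDivergence q X x ∂(riemannianVolume n M) =
      -∫ x, dirDeriv φ X x ∂(riemannianVolume n M) := by
  set e := chartAt (EuclideanSpace ℝ (Fin n)) q with he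
  have hφd := hφ.mdifferentiable one_ne_zero
  have hzero : ∀ x ∉ tsupport φ, φ =ᶠ[𝓝 x] fun _ ↦ 0 := fun x hx ↦
    notMem_tsupport_iff_eventuallyEq.1 hx
  have hdirzero : ∀ x ∉ tsupport φ, dirDeriv φ X x = 0 := fun x hx ↦ by
    rw [dirDeriv, (hzero x hx).mfderiv_eq, mfderiv_const]
    rfl
  have hc1 : Continuous fun x ↦ φ x * chartDivergence q X x := by
    rw [continuous_iff_continuousAt]
    intro x
    by_cases hx : x ∈ tsupport φ
    · exact (hφ.continuous.continuousOn.mul (continuousOn_chartDivergence q hX)).continuousAt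
        (e.open_source.mem_nhds (hφq hx))
    · refine (continuousAt_const (y := (0 : ℝ))).congr ?_
      filter_upwards [hzero x hx] with z hz
      simp [hz]
  have hc2 := continuous_dirDeriv hφ hX
  refine ⟨hc1.integrable_riemannianVolume, ?_⟩
  rw [eq_neg_iff_add_eq_zero, ← integral_add hc1.integrable_riemannianVolume
    hc2.integrable_riemannianVolume,
    integral_riemannianVolume_of_continuousOn (q := q) (hc1.fun_add hc2).continuousOn fun x hx ↦ by
      have hx' : x ∉ tsupport φ := fun h ↦ hx (hφq h)
      simp [hdirzero x hx', image_eq_zero_of_notMem_tsupport hx']]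
  have hparts (j : Fin n) := integral_fderiv_mul_eq_zero (volume : Measure
    (EuclideanSpace ℝ (Fin n))) e.open_target
    ((HasCompactSupport.of_compactSpace φ).image_of_continuousOn (e.continuousOn.mono hφq))
    (by
      rintro _ ⟨x, hx, rfl⟩
      exact e.map_source (hφq hx))
    (contDiffOn_inChart (by simp) q hφ)
    (((contDiffOn_volDensity q).of_le (by simp)).mul (hX q j))
    (fun y hy ↦ show φ (e.symm y) = 0 from image_eq_zero_of_notMem_tsupport fun h ↦
      hy.2 ⟨_, h, e.right_inv hy.1⟩) (EuclideanSpace.single j (1 : ℝ))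
  -- Zero is written as the sum of the vanishing integrals over the coordinate directions; the
  -- integrands are then compared pointwise.
  rw [← Finset.sum_eq_zero fun j (_ : j ∈ Finset.univ) ↦ (hparts j).2,
    ← integral_finsetSum _ fun j _ ↦ (hparts j).1]
  refine setIntegral_congr_fun e.open_target.measurableSet fun y hy ↦ ?_
  have hs := e.map_target hy
  have hne := (volDensity_pos hy).ne'
  simp only [dirDeriv_eq_sum hs hφd X, chartDivergence, ← he, e.right_inv hy]
  rw [Finset.sum_add_distrib, mul_add, ← Finset.mul_sum]
  congr 1
  · rw [inChart, mul_left_comm, mul_inv_cancel_left₀ hne]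
  · rw [Finset.mul_sum]
    refine Finset.sum_congr rfl fun j _ ↦ ?_
    rw [partialDeriv]
    ring

/-- No transformation of second derivatives is needed: tested against functions supported in the
overlap, both expressions give `-∫ dφ(X)`, which mentions no chart. Hence they agree almost
everywhere, and by continuity everywhere. -/
theorem chartDivergence_eqOn (p q : M) {X : ∀ x : M, TangentSpace (𝓡 n) x}
    (hX : IsC1VectorField X) :
    Set.EqOn (chartDivergence p X) (chartDivergence q X)
      ((chartAt (EuclideanSpace ℝ (Fin n)) p).source ∩
        (chartAt (EuclideanSpace ℝ (Fin n)) q).source) := by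
  set U := (chartAt (EuclideanSpace ℝ (Fin n)) p).source ∩
    (chartAt (EuclideanSpace ℝ (Fin n)) q).source
  have hU : IsOpen U := (chartAt (EuclideanSpace ℝ (Fin n)) p).open_source.inter
    (chartAt (EuclideanSpace ℝ (Fin n)) q).open_source
  have hp : ContinuousOn (chartDivergence p X) U :=
    (continuousOn_chartDivergence p hX).mono Set.inter_subset_left
  have hq : ContinuousOn (chartDivergence q X) U :=
    (continuousOn_chartDivergence q hX).mono Set.inter_subset_right
  refine Measure.eqOn_open_of_ae_eq (μ := riemannianVolume n M) ?_ hU hp hq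
  rw [EventuallyEq, ae_restrict_iff' hU.measurableSet]
  have h := hU.ae_eq_zero_of_integral_contMDiff_smul_eq_zero (𝓡 n) (μ := riemannianVolume n M)
    (f := fun x ↦ chartDivergence p X x - chartDivergence q X x)
    ((hp.sub hq).locallyIntegrableOn hU.measurableSet) fun g hg _ hgU ↦ by
      obtain ⟨hip, hp'⟩ := integral_mul_chartDivergence hX (hg.of_le (by simp))
        (hgU.trans Set.inter_subset_left)
      obtain ⟨hiq, hq'⟩ := integral_mul_chartDivergence hX (hg.of_le (by simp))
        (hgU.trans Set.inter_subset_right)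
      simp only [smul_eq_mul, mul_sub]
      rw [integral_sub hip hiq, hp', hq', sub_self]
  filter_upwards [h] with x hx hxU using sub_eq_zero.1 (hx hxU)

theorem divergence_eq_chartDivergence {q x : M}
    (hx : x ∈ (chartAt (EuclideanSpace ℝ (Fin n)) q).source)
    {X : ∀ x : M, TangentSpace (𝓡 n) x} (hX : IsC1VectorField X) :
    divergence X x = chartDivergence q X x :=
  chartDivergence_eqOn x q hX ⟨mem_chart_source (EuclideanSpace ℝ (Fin n)) x, hx⟩

theorem continuous_divergence {X : ∀ x : M, TangentSpace (𝓡 n) x} (hX : IsC1VectorField X) :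
    Continuous (divergence X) := by
  rw [continuous_iff_continuousAt]
  intro q
  exact ((continuousOn_chartDivergence q hX).congr fun x hx ↦
    divergence_eq_chartDivergence hx hX).continuousAt
    ((chartAt (EuclideanSpace ℝ (Fin n)) q).open_source.mem_nhds
      (mem_chart_source (EuclideanSpace ℝ (Fin n)) q))

/-- The divergence theorem on a closed manifold, in the form of an integration by parts. -/
theorem integral_mul_divergence {X : ∀ x : M, TangentSpace (𝓡 n) x}
    (hX : IsC1VectorField X) {φ : M → ℝ} (hφ : ContMDiff (𝓡 n) 𝓘(ℝ, ℝ) 1 φ) :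
    ∫ x, φ x * divergence X x ∂(riemannianVolume n M) =
      -∫ x, dirDeriv φ X x ∂(riemannianVolume n M) := by
  -- The test function is cut into pieces supported in charts while the field stays whole, so the
  -- local formula applies to each piece and the pieces sum back by linearity of the derivative.
  have hρ (p : M) : ContMDiff (𝓡 n) 𝓘(ℝ, ℝ) 1 fun x ↦ chartPartition n M p x * φ x :=
    ((chartPartition n M p).contMDiff.of_le (by simp)).mul hφ
  have hsupp (p : M) : tsupport (fun x ↦ chartPartition n M p x * φ x) ⊆
      (chartAt (EuclideanSpace ℝ (Fin n)) p).source :=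
    (tsupport_mul_subset_left (f := chartPartition n M p) (g := φ)).trans
      (tsupport_chartPartition_subset p)
  have hsum (x : M) : φ x = ∑ p ∈ chartPartitionIndices n M, chartPartition n M p x * φ x := by
    rw [← Finset.sum_mul, sum_chartPartition, one_mul]
  have hlocal (p : M) : ∫ x, chartPartition n M p x * φ x * divergence X x
      ∂(riemannianVolume n M) =
      -∫ x, dirDeriv (fun x ↦ chartPartition n M p x * φ x) X x ∂(riemannianVolume n M) := by
    rw [← (integral_mul_chartDivergence hX (hρ p) (hsupp p)).2]
    refine integral_congr_ae (ae_of_all _ fun x ↦ ?_)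
    by_cases hx : x ∈ (chartAt (EuclideanSpace ℝ (Fin n)) p).source
    · simp only [divergence_eq_chartDivergence hx hX]
    · have h0 : chartPartition n M p x * φ x = 0 :=
        image_eq_zero_of_notMem_tsupport (f := fun x ↦ chartPartition n M p x * φ x)
          fun h ↦ hx (hsupp p h)
      simp only [h0, zero_mul]
  calc _ = ∫ x, ∑ p ∈ chartPartitionIndices n M, chartPartition n M p x * φ x * divergence X x
        ∂(riemannianVolume n M) := by
        refine integral_congr_ae (ae_of_all _ fun x ↦ ?_)
        simp only
        rw [← Finset.sum_mul, ← hsum]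
    _ = ∑ p ∈ chartPartitionIndices n M,
        -∫ x, dirDeriv (fun x ↦ chartPartition n M p x * φ x) X x ∂(riemannianVolume n M) := by
        rw [integral_finsetSum _ fun p _ ↦
          ((hρ p).continuous.fun_mul (continuous_divergence hX)).integrable_riemannianVolume]
        exact Finset.sum_congr rfl fun p _ ↦ hlocal p
    _ = _ := by
        rw [Finset.sum_neg_distrib, ← integral_finsetSum _ fun p _ ↦
          (continuous_dirDeriv (hρ p) hX).integrable_riemannianVolume]
        congr 1
        refine integral_congr_ae (ae_of_all _ fun x ↦ ?_)
        have hfun : φ = fun x ↦ ∑ p ∈ chartPartitionIndices n M, chartPartition n M p x * φ x :=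
          funext hsum
        have hd := hφ.mdifferentiable one_ne_zero
        simp only
        conv_rhs => rw [hfun]
        rw [dirDeriv_sum (fun p ↦ (hρ p).mdifferentiable one_ne_zero) (hfun ▸ hd)]

end Divergence

/-! ### Calculus of inner products of gradients. -/

section GradientInner

variable {n : ℕ} {M : Type*} [TopologicalSpace M] [ChartedSpace (EuclideanSpace ℝ (Fin n)) M]
  [RiemannianBundle (fun x : M ↦ TangentSpace (𝓡 n) x)]

variable (n) in
/-- The inner product of the gradients of two functions. -/
def gradInner (u v : M → ℝ) (x : M) : ℝ :=
  inner ℝ (grad (n := n) u x) (grad v x)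

theorem gradInner_comm (u v : M → ℝ) (x : M) : gradInner n u v x = gradInner n v u x :=
  real_inner_comm _ _

theorem gradInner_self (u : M → ℝ) (x : M) :
    gradInner n u u x = ‖(grad u x : TangentSpace (𝓡 n) x)‖ ^ 2 :=
  real_inner_self_eq_norm_sq _

theorem gradInner_self_nonneg (u : M → ℝ) (x : M) : 0 ≤ gradInner n u u x :=
  real_inner_self_nonneg

theorem gradInner_eq_dirDeriv (u v : M → ℝ) (x : M) :
    gradInner n u v x = dirDeriv (n := n) u (grad v) x := inner_grad_left u (grad v) x

theorem dirDeriv_smul_grad (a u v : M → ℝ) (x : M) :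
    dirDeriv v (fun z ↦ a z • grad (n := n) u z) x = a x * gradInner n u v x := by
  rw [gradInner_comm, gradInner_eq_dirDeriv]
  exact (mfderiv (𝓡 n) 𝓘(ℝ, ℝ) v x).map_smul (a x) (grad u x)

theorem dirDeriv_eq_zero_of_gradInner_self_eq_zero {u : M → ℝ} {x : M}
    (h : gradInner n u u x = 0) (X : ∀ x : M, TangentSpace (𝓡 n) x) : dirDeriv u X x = 0 := by
  have h' : (grad u x : TangentSpace (𝓡 n) x) = 0 := inner_self_eq_zero.1 h
  rw [← inner_grad_left, h']
  exact inner_zero_left _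

variable [IsManifold (𝓡 n) ∞ M]

theorem gradInner_mul_left {φ ψ : M → ℝ} (hφ : MDifferentiable (𝓡 n) 𝓘(ℝ, ℝ) φ)
    (hψ : MDifferentiable (𝓡 n) 𝓘(ℝ, ℝ) ψ)
    (hm : MDifferentiable (𝓡 n) 𝓘(ℝ, ℝ) (fun x ↦ φ x * ψ x)) (v : M → ℝ) (x : M) :
    gradInner n (fun x ↦ φ x * ψ x) v x =
      φ x * gradInner n ψ v x + ψ x * gradInner n φ v x := by
  simp only [gradInner_eq_dirDeriv]
  exact dirDeriv_mul hφ hψ hm _ x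

omit [IsManifold (𝓡 n) ∞ M] in
theorem gradInner_add_left {φ ψ : M → ℝ} (hφ : MDifferentiable (𝓡 n) 𝓘(ℝ, ℝ) φ)
    (hψ : MDifferentiable (𝓡 n) 𝓘(ℝ, ℝ) ψ) (v : M → ℝ) (x : M) :
    gradInner n (fun x ↦ φ x + ψ x) v x = gradInner n φ v x + gradInner n ψ v x := by
  simp only [gradInner_eq_dirDeriv, dirDeriv]
  exact DFunLike.congr_fun (mfderiv_add (hφ x) (hψ x)) (grad v x)

omit [IsManifold (𝓡 n) ∞ M] in
theorem gradInner_const_mul_left {φ : M → ℝ} (hφ : MDifferentiable (𝓡 n) 𝓘(ℝ, ℝ) φ)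
    (s : ℝ) (v : M → ℝ) (x : M) :
    gradInner n (fun x ↦ s * φ x) v x = s * gradInner n φ v x := by
  simp only [gradInner_eq_dirDeriv, dirDeriv]
  exact DFunLike.congr_fun (const_smul_mfderiv (hφ x) s) (grad v x)

/-- A function with vanishing gradient on a connected manifold is constant. -/
theorem eq_of_gradInner_self_eq_zero [PreconnectedSpace M] {f : M → ℝ}
    (hf : ContMDiff (𝓡 n) 𝓘(ℝ, ℝ) 1 f) (h : ∀ x, gradInner n f f x = 0) (x y : M) :
    f x = f y := by
  have hfd := hf.mdifferentiable one_ne_zero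
  suffices hl : IsLocallyConstant f from
    hl.apply_eq_of_isPreconnected isPreconnected_univ (Set.mem_univ x) (Set.mem_univ y)
  intro t
  rw [isOpen_iff_mem_nhds]
  intro p hp
  set e := chartAt (EuclideanSpace ℝ (Fin n)) p
  -- A function with zero derivative on an open set is locally constant, so the preimage of an
  -- arbitrary set `t` is open in the chart.
  have ho : IsOpen (e.target ∩ inChart p f ⁻¹' t) :=
    e.open_target.isOpen_inter_preimage_of_fderiv_eq_zero
      ((contDiffOn_inChart (by simp) p hf).differentiableOn one_ne_zero) (fun y hy ↦ by
        ext v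
        rw [fderiv_inChart_eq hy hfd]
        exact dirDeriv_eq_zero_of_gradInner_self_eq_zero (h _) _) t
  have hps := mem_chart_source (EuclideanSpace ℝ (Fin n)) p
  filter_upwards [(e.isOpen_inter_preimage ho).mem_nhds ⟨hps, e.map_source hps, by
    simpa [inChart, e, e.left_inv hps] using hp⟩] with z hz
  have := hz.2.2
  simpa [inChart, e, e.left_inv hz.1] using this

variable [IsContMDiffRiemannianBundle (𝓡 n) ∞ (EuclideanSpace ℝ (Fin n))
    (fun x : M ↦ TangentSpace (𝓡 n) x)]

theorem continuous_gradInner {u v : M → ℝ} (hu : ContMDiff (𝓡 n) 𝓘(ℝ, ℝ) 2 u)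
    (hv : ContMDiff (𝓡 n) 𝓘(ℝ, ℝ) 2 v) : Continuous (gradInner n u v) :=
  (continuous_dirDeriv (hu.of_le one_le_two) (isC1VectorField_grad hv)).congr
    fun x ↦ (gradInner_eq_dirDeriv u v x).symm

end GradientInner

/-! ### Green's identity and non-negativity of the energy. -/

section Energy

variable {n : ℕ} {M : Type*} [TopologicalSpace M] [ChartedSpace (EuclideanSpace ℝ (Fin n)) M]
  [RiemannianBundle (fun x : M ↦ TangentSpace (𝓡 n) x)] [IsManifold (𝓡 n) ∞ M]
  [IsContMDiffRiemannianBundle (𝓡 n) ∞ (EuclideanSpace ℝ (Fin n))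
    (fun x : M ↦ TangentSpace (𝓡 n) x)]
  [T2Space M] [CompactSpace M] [MeasurableSpace M] [BorelSpace M]

/-- Green's identity for the operator `L`. -/
theorem integral_mul_opL {a c u v : M → ℝ} (ha : ContMDiff (𝓡 n) 𝓘(ℝ, ℝ) 1 a)
    (hc : Continuous c) (hu : ContMDiff (𝓡 n) 𝓘(ℝ, ℝ) 2 u) (hv : ContMDiff (𝓡 n) 𝓘(ℝ, ℝ) 2 v) :
    ∫ x, v x * opL n a c u x ∂(riemannianVolume n M) =
      ∫ x, (a x * gradInner n u v x + c x * (u x * v x)) ∂(riemannianVolume n M) := by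
  have hX := (isC1VectorField_grad hu).smul ha
  have hv1 : ContMDiff (𝓡 n) 𝓘(ℝ, ℝ) 1 v := hv.of_le one_le_two
  have h1 : Integrable (fun x ↦ v x * divergence (n := n) (fun z ↦ a z • grad u z) x)
      (riemannianVolume n M) :=
    (hv.continuous.mul (continuous_divergence hX)).integrable_riemannianVolume
  have h2 : Integrable (fun x ↦ c x * (u x * v x)) (riemannianVolume n M) :=
    (hc.mul (hu.continuous.mul hv.continuous)).integrable_riemannianVolume
  have h3 : Integrable (fun x ↦ a x * gradInner n u v x) (riemannianVolume n M) :=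
    (ha.continuous.mul (continuous_gradInner hu hv)).integrable_riemannianVolume
  have h4 := integral_mul_divergence hX hv1
  simp only [dirDeriv_smul_grad] at h4
  rw [integral_add h3 h2, ← neg_eq_iff_eq_neg.2 h4, ← integral_neg, ← integral_add h1.fun_neg h2]
  refine integral_congr_ae (ae_of_all _ fun x ↦ ?_)
  simp only [opL]
  ring

/-- Makes `C²` functions admissible in the Rayleigh quotient; the approximating sequence is
constant. -/
theorem hasSobolevGradient_grad {w : M → ℝ} (hw : ContMDiff (𝓡 n) 𝓘(ℝ, ℝ) 2 w) :
    HasSobolevGradient (n := n) w (grad w) where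
  memLp := (memLp_two_iff_integrable_sq hw.continuous.aestronglyMeasurable).2
    (hw.continuous.pow 2).integrable_riemannianVolume
  aestronglyMeasurable_inner Y hY :=
    ((continuous_dirDeriv_of_contMDiff (hw.of_le one_le_two) hY).congr
      fun x ↦ (inner_grad_left w Y x).symm).aestronglyMeasurable
  integrable_norm_sq := by
    simp only [← gradInner_self]
    exact (continuous_gradInner hw hw).integrable_riemannianVolume
  approx := ⟨fun _ ↦ w, fun _ ↦ hw.of_le one_le_two, by simp, by simp⟩

omit [IsContMDiffRiemannianBundle (𝓡 n) ∞ (EuclideanSpace ℝ (Fin n))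
    (fun x : M ↦ TangentSpace (𝓡 n) x)] in
-- A lower bound of `c` bounds the quotients, since the gradient term is non-negative. Without such
-- a bound the real `sInf` would say nothing about individual quotients.
theorem bddBelow_rayleighQuotients {a c : M → ℝ} (ha : Continuous a) (ha0 : ∀ x, 0 ≤ a x)
    (hc : Continuous c) :
    BddBelow {r : ℝ | ∃ (u : M → ℝ) (X : ∀ x : M, TangentSpace (𝓡 n) x),
      HasSobolevGradient u X ∧ ¬ (u =ᵐ[riemannianVolume n M] 0) ∧
      r = (∫ x, (a x * ‖X x‖ ^ 2 + c x * u x ^ 2) ∂(riemannianVolume n M)) /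
        ∫ x, u x ^ 2 ∂(riemannianVolume n M)} := by
  obtain ⟨C, hC⟩ := (isCompact_range hc).bddBelow
  obtain ⟨A, hA⟩ := (isCompact_range ha.norm).bddAbove
  obtain ⟨B, hB⟩ := (isCompact_range hc.norm).bddAbove
  refine ⟨C, ?_⟩
  rintro _ ⟨u, X, h, hne, rfl⟩
  have hu2 := h.memLp.integrable_sq
  have hpos : 0 < ∫ x, u x ^ 2 ∂(riemannianVolume n M) := by
    refine (integral_nonneg fun x ↦ sq_nonneg _).lt_of_ne' fun h0 ↦ hne ?_
    filter_upwards [(integral_eq_zero_iff_of_nonneg (fun x ↦ sq_nonneg (u x)) hu2).1 h0] with x hx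
    simpa using hx
  have h1 : Integrable (fun x ↦ a x * ‖X x‖ ^ 2) (riemannianVolume n M) :=
    h.integrable_norm_sq.bdd_mul ha.aestronglyMeasurable
      (ae_of_all _ fun x ↦ hA (Set.mem_range_self x))
  have h2 : Integrable (fun x ↦ c x * u x ^ 2) (riemannianVolume n M) :=
    hu2.bdd_mul hc.aestronglyMeasurable (ae_of_all _ fun x ↦ hB (Set.mem_range_self x))
  rw [le_div_iff₀ hpos, ← integral_const_mul]
  refine integral_mono (hu2.const_mul C) (h1.add h2) fun x ↦ ?_
  have := mul_nonneg (ha0 x) (sq_nonneg ‖X x‖)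
  have := mul_le_mul_of_nonneg_right (hC (Set.mem_range_self x)) (sq_nonneg (u x))
  simp only
  linarith

/-- For `w` not almost everywhere zero, the energy has the sign of its Rayleigh quotient. The
remaining `w` are not admissible there, but for them only the gradient term survives. -/
theorem energy_nonneg {a c : M → ℝ} (ha : Continuous a) (ha0 : ∀ x, 0 ≤ a x)
    (hc : Continuous c) (hlambda : 0 ≤ firstEigenvalue n a c) {w : M → ℝ}
    (hw : ContMDiff (𝓡 n) 𝓘(ℝ, ℝ) 2 w) :
    0 ≤ ∫ x, (a x * ‖(grad w x : TangentSpace (𝓡 n) x)‖ ^ 2 + c x * w x ^ 2)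
      ∂(riemannianVolume n M) := by
  by_cases hne : w =ᵐ[riemannianVolume n M] 0
  · refine integral_nonneg_of_ae ?_
    filter_upwards [hne] with x hx
    have := mul_nonneg (ha0 x) (sq_nonneg ‖(grad w x : TangentSpace (𝓡 n) x)‖)
    simpa [hx] using this
  · have h := hlambda.trans (csInf_le (bddBelow_rayleighQuotients ha ha0 hc)
      ⟨w, grad w, hasSobolevGradient_grad hw, hne, rfl⟩)
    by_contra hneg
    push Not at hneg
    have h2 : 0 ≤ ∫ x, w x ^ 2 ∂(riemannianVolume n M) := integral_nonneg fun x ↦ sq_nonneg _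
    rcases h2.eq_or_lt with h0 | h0
    · refine hne ?_
      filter_upwards [(integral_eq_zero_iff_of_nonneg (fun x ↦ sq_nonneg (w x))
        (hw.continuous.pow 2).integrable_riemannianVolume).1 h0.symm] with x hx
      simpa using hx
    · exact (div_neg_of_neg_of_pos hneg h0).not_ge h

theorem integral_pos_of_continuous_of_pos [Nonempty M] {f : M → ℝ} (hf : Continuous f)
    (h : ∀ x, 0 < f x) : 0 < ∫ x, f x ∂(riemannianVolume n M) :=
  hf.integral_pos_of_hasCompactSupport_nonneg_nonzero (HasCompactSupport.of_compactSpace f)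
    (fun x ↦ (h x).le) (h (Classical.arbitrary M)).ne'

theorem eq_zero_of_integral_nonpos {f : M → ℝ} (hf : Continuous f) (h : ∀ x, 0 ≤ f x)
    (hi : ∫ x, f x ∂(riemannianVolume n M) ≤ 0) (x : M) : f x = 0 := by
  by_contra hx
  exact hi.not_gt (hf.integral_pos_of_hasCompactSupport_nonneg_nonzero
    (HasCompactSupport.of_compactSpace f) h hx)

end Energy

/-! ### Uniqueness of positive solutions up to scaling. -/

section Uniqueness

variable {n : ℕ} {M : Type*} [TopologicalSpace M] [ChartedSpace (EuclideanSpace ℝ (Fin n)) M]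
  [RiemannianBundle (fun x : M ↦ TangentSpace (𝓡 n) x)] [IsManifold (𝓡 n) ∞ M]
  [IsContMDiffRiemannianBundle (𝓡 n) ∞ (EuclideanSpace ℝ (Fin n))
    (fun x : M ↦ TangentSpace (𝓡 n) x)]
  [T2Space M] [CompactSpace M] [ConnectedSpace M] [MeasurableSpace M] [BorelSpace M]
  {a c u₁ u₂ : M → ℝ} {K₁ K₂ : ℝ}

omit [ConnectedSpace M] in
theorem integral_opL_symm (ha : ContMDiff (𝓡 n) 𝓘(ℝ, ℝ) 1 a) (hc : Continuous c)
    (hu₁ : ContMDiff (𝓡 n) 𝓘(ℝ, ℝ) 2 u₁) (hu₂ : ContMDiff (𝓡 n) 𝓘(ℝ, ℝ) 2 u₂) :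
    ∫ x, u₂ x * opL n a c u₁ x ∂(riemannianVolume n M) =
      ∫ x, u₁ x * opL n a c u₂ x ∂(riemannianVolume n M) := by
  rw [integral_mul_opL ha hc hu₁ hu₂, integral_mul_opL ha hc hu₂ hu₁]
  simp only [gradInner_comm u₁ u₂, mul_comm (u₁ _)]

omit [ConnectedSpace M] in
-- The linearity is taken on the gradient side, where it is pointwise, and Green's identity is
-- applied to each `uᵢ` against the whole combination; linearity of `opL` itself is not needed.
theorem energy_combination (ha : ContMDiff (𝓡 n) 𝓘(ℝ, ℝ) 1 a) (hc : Continuous c)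
    (hu₁ : ContMDiff (𝓡 n) 𝓘(ℝ, ℝ) 2 u₁) (hu₂ : ContMDiff (𝓡 n) 𝓘(ℝ, ℝ) 2 u₂)
    (hL₁ : Continuous (opL n a c u₁)) (hL₂ : Continuous (opL n a c u₂)) (s t : ℝ) :
    ∫ x, (a x * gradInner n (fun x ↦ s * u₁ x + t * u₂ x) (fun x ↦ s * u₁ x + t * u₂ x) x +
        c x * (s * u₁ x + t * u₂ x) ^ 2) ∂(riemannianVolume n M) =
      ∫ x, (s * u₁ x + t * u₂ x) * (s * opL n a c u₁ x + t * opL n a c u₂ x)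
        ∂(riemannianVolume n M) := by
  have hs₁ : ContMDiff (𝓡 n) 𝓘(ℝ, ℝ) 2 fun x ↦ s * u₁ x := contMDiff_const.mul hu₁
  have ht₂ : ContMDiff (𝓡 n) 𝓘(ℝ, ℝ) 2 fun x ↦ t * u₂ x := contMDiff_const.mul hu₂
  have hw : ContMDiff (𝓡 n) 𝓘(ℝ, ℝ) 2 fun x ↦ s * u₁ x + t * u₂ x := hs₁.add ht₂
  set w : M → ℝ := fun x ↦ s * u₁ x + t * u₂ x with hwdef
  have hg (x : M) : gradInner n w w x =
      s * gradInner n u₁ w x + t * gradInner n u₂ w x := by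
    conv_lhs => rw [hwdef]
    rw [gradInner_add_left (hs₁.mdifferentiable two_ne_zero) (ht₂.mdifferentiable two_ne_zero),
      gradInner_const_mul_left (hu₁.mdifferentiable two_ne_zero),
      gradInner_const_mul_left (hu₂.mdifferentiable two_ne_zero)]
  have hi {u : M → ℝ} (hu : ContMDiff (𝓡 n) 𝓘(ℝ, ℝ) 2 u) :
      Integrable (fun x ↦ a x * gradInner n u w x + c x * (u x * w x)) (riemannianVolume n M) :=
    ((ha.continuous.fun_mul (continuous_gradInner hu hw)).fun_add
      (hc.mul (hu.continuous.mul hw.continuous))).integrable_riemannianVolume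
  have hwL {u : M → ℝ} (hL : Continuous (opL n a c u)) :
      Integrable (fun x ↦ w x * opL n a c u x) (riemannianVolume n M) :=
    (hw.continuous.fun_mul hL).integrable_riemannianVolume
  calc _ = s * (∫ x, (a x * gradInner n u₁ w x + c x * (u₁ x * w x)) ∂(riemannianVolume n M)) +
        t * ∫ x, (a x * gradInner n u₂ w x + c x * (u₂ x * w x)) ∂(riemannianVolume n M) := by
        rw [← integral_const_mul, ← integral_const_mul,
          ← integral_add ((hi hu₁).const_mul s) ((hi hu₂).const_mul t)]
        refine integral_congr_ae (ae_of_all _ fun x ↦ ?_)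
        simp only [hg]
        rw [hwdef]
        ring
    _ = _ := by
        rw [← integral_mul_opL ha hc hu₁ hw, ← integral_mul_opL ha hc hu₂ hw,
          ← integral_const_mul, ← integral_const_mul,
          ← integral_add ((hwL hL₁).const_mul s) ((hwL hL₂).const_mul t)]
        refine integral_congr_ae (ae_of_all _ fun x ↦ ?_)
        simp only
        ring

/-- Positive functions in the kernel of `L` are proportional. -/
theorem exists_eq_mul_of_opL_eq_zero (ha : ContMDiff (𝓡 n) 𝓘(ℝ, ℝ) 1 a) (ha0 : ∀ x, 0 < a x)
    (hc : Continuous c)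
    (hu₁ : ContMDiff (𝓡 n) 𝓘(ℝ, ℝ) 2 u₁) (hu₂ : ContMDiff (𝓡 n) 𝓘(ℝ, ℝ) 2 u₂)
    (hpos₁ : ∀ x, 0 < u₁ x) (hpos₂ : ∀ x, 0 < u₂ x)
    (hL₁ : ∀ x, opL n a c u₁ x = 0) (hL₂ : ∀ x, opL n a c u₂ x = 0) :
    ∃ β : ℝ, 0 < β ∧ ∀ x, u₁ x = β * u₂ x := by
  set f : M → ℝ := fun x ↦ u₁ x / u₂ x with hfdef
  have hf : ContMDiff (𝓡 n) 𝓘(ℝ, ℝ) 2 f := hu₁.div₀ hu₂ fun x ↦ (hpos₂ x).ne'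
  have hfu : u₁ = fun x ↦ f x * u₂ x := funext fun x ↦ (div_mul_cancel₀ _ (hpos₂ x).ne').symm
  have hv : ContMDiff (𝓡 n) 𝓘(ℝ, ℝ) 2 fun x ↦ f x * u₁ x := hf.mul hu₁
  have hfd := hf.mdifferentiable two_ne_zero
  have hu₁d := hu₁.mdifferentiable two_ne_zero
  have hu₂d := hu₂.mdifferentiable two_ne_zero
  have hg₁ (v : M → ℝ) (x : M) :
      gradInner n u₁ v x = f x * gradInner n u₂ v x + u₂ x * gradInner n f v x := by
    conv_lhs => rw [hfu]
    exact gradInner_mul_left hfd hu₂d (hfu ▸ hu₁d) v x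
  have hgv (v : M → ℝ) (x : M) : gradInner n (fun x ↦ f x * u₁ x) v x =
      f x * gradInner n u₁ v x + u₁ x * gradInner n f v x :=
    gradInner_mul_left hfd hu₁d (hv.mdifferentiable two_ne_zero) v x
  have hi {u v : M → ℝ} (hu : ContMDiff (𝓡 n) 𝓘(ℝ, ℝ) 2 u) (hv : ContMDiff (𝓡 n) 𝓘(ℝ, ℝ) 2 v) :
      Integrable (fun x ↦ a x * gradInner n u v x + c x * (u x * v x)) (riemannianVolume n M) :=
    ((ha.continuous.fun_mul (continuous_gradInner hu hv)).fun_add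
      (hc.mul (hu.continuous.mul hv.continuous))).integrable_riemannianVolume
  have h1 := integral_mul_opL ha hc hu₁ hu₁
  have h2 := integral_mul_opL ha hc hu₂ hv
  simp only [hL₁, hL₂, mul_zero, integral_zero] at h1 h2
  -- Test `L u₁ = 0` with `u₁` and `L u₂ = 0` with `f u₁ = f² u₂`, then subtract. The terms with `c`
  -- cancel, and `|∇u₁|² - ⟨∇u₂, ∇(f² u₂)⟩ = u₂² |∇f|²`.
  have hzero : ∫ x, a x * u₂ x ^ 2 * gradInner n f f x ∂(riemannianVolume n M) = 0 := by
    rw [← sub_self (0 : ℝ)]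
    nth_rewrite 1 [h1]
    rw [h2, ← integral_sub (hi hu₁ hu₁) (hi hu₂ hv)]
    refine integral_congr_ae (ae_of_all _ fun x ↦ ?_)
    simp only
    have e0 := congrFun hfu x
    rw [gradInner_comm u₂, hgv, hg₁ u₁, gradInner_comm u₂ u₁, gradInner_comm f u₁, hg₁ u₂,
      hg₁ f, gradInner_comm u₂ f, e0]
    ring
  have hfz (x : M) : gradInner n f f x = 0 := by
    have h := eq_zero_of_integral_nonpos
      ((ha.continuous.mul (hu₂.continuous.pow 2)).fun_mul (continuous_gradInner hf hf))
      (fun x ↦ mul_nonneg (mul_nonneg (ha0 x).le (sq_nonneg _)) (gradInner_self_nonneg f x))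
      hzero.le x
    exact (mul_eq_zero.1 h).resolve_left (mul_pos (ha0 x) (pow_pos (hpos₂ x) 2)).ne'
  obtain ⟨x₀⟩ : Nonempty M := inferInstance
  refine ⟨f x₀, div_pos (hpos₁ x₀) (hpos₂ x₀), fun x ↦ ?_⟩
  rw [← eq_of_gradInner_self_eq_zero (hf.of_le one_le_two) hfz x x₀]
  exact congrFun hfu x

theorem inv_pow_sub_mul_sub_nonpos {v w : ℝ} (hv : 0 < v) (hw : 0 < w) (k : ℕ) :
    (v - w) * ((v ^ k)⁻¹ - (w ^ k)⁻¹) ≤ 0 := by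
  rcases le_total v w with h | h
  · exact mul_nonpos_of_nonpos_of_nonneg (sub_nonpos.2 h) (sub_nonneg.2
      (inv_anti₀ (pow_pos hv k) (pow_le_pow_left₀ hv.le h k)))
  · exact mul_nonpos_of_nonneg_of_nonpos (sub_nonneg.2 h) (sub_nonpos.2
      (inv_anti₀ (pow_pos hw k) (pow_le_pow_left₀ hw.le h k)))

theorem eq_of_inv_pow_sub_mul_sub_eq_zero {v w : ℝ} (hv : 0 < v) (hw : 0 < w) {k : ℕ}
    (hk : k ≠ 0) (h : (v - w) * ((v ^ k)⁻¹ - (w ^ k)⁻¹) = 0) : v = w := by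
  rcases mul_eq_zero.1 h with h | h
  · exact sub_eq_zero.1 h
  · exact (pow_left_inj₀ hv.le hw.le hk).1 (inv_injective (sub_eq_zero.1 h))

/-- The exponent is six because `s K u⁻⁵ = (s⁶ K) (s u)⁻⁵`, so `s = K^(-1/6)` normalizes the
equation. -/
theorem exists_pos_pow_six_mul_eq_one {K : ℝ} (hK : 0 < K) : ∃ s : ℝ, 0 < s ∧ s ^ 6 * K = 1 := by
  refine ⟨(K⁻¹) ^ (6 : ℝ)⁻¹, Real.rpow_pos_of_pos (inv_pos.2 hK) _, ?_⟩
  have h := Real.rpow_inv_natCast_pow (inv_pos.2 hK).le (n := 6) (by norm_num)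
  push_cast at h
  rw [h, inv_mul_cancel₀ hK.ne']

/-- Positive solutions of `L u = K u⁻⁵` are unique up to a constant factor, for non-negative `K`
which may depend on the solution, if the quadratic form of `L` is non-negative. -/
theorem exists_eq_mul_of_opL_eq (ha : ContMDiff (𝓡 n) 𝓘(ℝ, ℝ) 1 a) (ha0 : ∀ x, 0 < a x)
    (hc : Continuous c) (hlambda : 0 ≤ firstEigenvalue n a c)
    (hu₁ : ContMDiff (𝓡 n) 𝓘(ℝ, ℝ) 2 u₁) (hu₂ : ContMDiff (𝓡 n) 𝓘(ℝ, ℝ) 2 u₂)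
    (hpos₁ : ∀ x, 0 < u₁ x) (hpos₂ : ∀ x, 0 < u₂ x) (hK₁ : 0 ≤ K₁) (hK₂ : 0 ≤ K₂)
    (hL₁ : ∀ x, opL n a c u₁ x = K₁ * (u₁ x ^ 5)⁻¹)
    (hL₂ : ∀ x, opL n a c u₂ x = K₂ * (u₂ x ^ 5)⁻¹) :
    ∃ β : ℝ, 0 < β ∧ ∀ x, u₁ x = β * u₂ x := by
  have hinv {u : M → ℝ} (hu : ContMDiff (𝓡 n) 𝓘(ℝ, ℝ) 2 u) (hpos : ∀ x, 0 < u x) :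
      Continuous fun x ↦ (u x ^ 5)⁻¹ :=
    (hu.continuous.pow 5).inv₀ fun x ↦ (pow_pos (hpos x) 5).ne'
  have hI {u v : M → ℝ} (hu : ContMDiff (𝓡 n) 𝓘(ℝ, ℝ) 2 u) (hpos : ∀ x, 0 < u x)
      (hv : ContMDiff (𝓡 n) 𝓘(ℝ, ℝ) 2 v) (hposv : ∀ x, 0 < v x) :
      0 < ∫ x, v x * (u x ^ 5)⁻¹ ∂(riemannianVolume n M) :=
    integral_pos_of_continuous_of_pos (hv.continuous.mul (hinv hu hpos)) fun x ↦
      mul_pos (hposv x) (inv_pos.2 (pow_pos (hpos x) 5))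
  -- Symmetry reads `K₁ ∫ u₂ u₁⁻⁵ = K₂ ∫ u₁ u₂⁻⁵` with positive integrals, so `K₁` and `K₂` vanish
  -- together.
  have hsymm := integral_opL_symm ha hc hu₁ hu₂
  simp only [hL₁, hL₂, mul_left_comm _ K₁, mul_left_comm _ K₂, integral_const_mul] at hsymm
  have hI₁ := hI hu₁ hpos₁ hu₂ hpos₂
  have hI₂ := hI hu₂ hpos₂ hu₁ hpos₁
  rcases hK₁.eq_or_lt with h₁ | h₁
  · rw [← h₁, zero_mul] at hsymm
    have h₂ : K₂ = 0 := (mul_eq_zero.1 hsymm.symm).resolve_right hI₂.ne'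
    exact exists_eq_mul_of_opL_eq_zero ha ha0 hc hu₁ hu₂ hpos₁ hpos₂
      (fun x ↦ by rw [hL₁, ← h₁, zero_mul]) fun x ↦ by rw [hL₂, h₂, zero_mul]
  have h₂ : 0 < K₂ := hK₂.lt_of_ne' fun h ↦ by
    rw [h, zero_mul] at hsymm
    exact (mul_pos h₁ hI₁).ne' hsymm
  obtain ⟨s, hs, hsK⟩ := exists_pos_pow_six_mul_eq_one h₁
  obtain ⟨t, ht, htK⟩ := exists_pos_pow_six_mul_eq_one h₂
  have hLc₁ : Continuous (opL n a c u₁) := by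
    rw [funext hL₁]
    exact continuous_const.mul (hinv hu₁ hpos₁)
  have hLc₂ : Continuous (opL n a c u₂) := by
    rw [funext hL₂]
    exact continuous_const.mul (hinv hu₂ hpos₂)
  -- The energy of `s u₁ - t u₂` is bounded below by zero through the eigenvalue, and its integrand
  -- after Green's identity is non-positive by monotonicity.
  have hcomb := energy_combination ha hc hu₁ hu₂ hLc₁ hLc₂ s (-t)
  have hw : ContMDiff (𝓡 n) 𝓘(ℝ, ℝ) 2 fun x ↦ s * u₁ x + -t * u₂ x :=
    (contMDiff_const.mul hu₁).add (contMDiff_const.mul hu₂)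
  have henergy := energy_nonneg ha.continuous (fun x ↦ (ha0 x).le) hc hlambda hw
  simp only [← gradInner_self] at henergy
  rw [hcomb] at henergy
  have hscale {s K u : ℝ} (hs : 0 < s) (hsK : s ^ 6 * K = 1) (hu : 0 < u) :
      s * (K * (u ^ 5)⁻¹) = ((s * u) ^ 5)⁻¹ := by
    rw [mul_pow, eq_comm, inv_eq_one_div, div_eq_iff (by positivity)]
    field_simp
    linear_combination -hsK
  have hint (x : M) : (s * u₁ x + -t * u₂ x) * (s * opL n a c u₁ x + -t * opL n a c u₂ x) =
      (s * u₁ x - t * u₂ x) * (((s * u₁ x) ^ 5)⁻¹ - ((t * u₂ x) ^ 5)⁻¹) := by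
    rw [hL₁, hL₂, neg_mul, neg_mul, hscale hs hsK (hpos₁ x), hscale ht htK (hpos₂ x)]
    ring
  have hzero := eq_zero_of_integral_nonpos (n := n)
    (f := fun x ↦ -((s * u₁ x + -t * u₂ x) * (s * opL n a c u₁ x + -t * opL n a c u₂ x)))
    (hw.continuous.fun_mul ((continuous_const.mul hLc₁).add (continuous_const.mul hLc₂))).fun_neg
    (fun x ↦ by
      rw [hint, neg_nonneg]
      exact inv_pow_sub_mul_sub_nonpos (mul_pos hs (hpos₁ x)) (mul_pos ht (hpos₂ x)) 5)
    (by rwa [integral_neg, neg_nonpos])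
  -- The pointwise conclusion is `s u₁ = t u₂`.
  refine ⟨t / s, div_pos ht hs, fun x ↦ ?_⟩
  have hx := hzero x
  rw [neg_eq_zero, hint] at hx
  have := eq_of_inv_pow_sub_mul_sub_eq_zero (mul_pos hs (hpos₁ x)) (mul_pos ht (hpos₂ x))
    (by norm_num) hx
  rw [div_mul_eq_mul_div, eq_div_iff hs.ne', mul_comm, this]

theorem intInvFour_pos {u : M → ℝ} (hu : Continuous u) (hpos : ∀ x, 0 < u x) :
    0 < intInvFour n u :=
  integral_pos_of_continuous_of_pos ((hu.pow 4).inv₀ fun x ↦ (pow_pos (hpos x) 4).ne')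
    fun x ↦ inv_pos.2 (pow_pos (hpos x) 4)

theorem functionalD_nonneg (ha : Continuous a) (ha0 : ∀ x, 0 ≤ a x)
    (hc : Continuous c) (hlambda : 0 ≤ firstEigenvalue n a c) {u : M → ℝ}
    (hu : ContMDiff (𝓡 n) 𝓘(ℝ, ℝ) 2 u) (hpos : ∀ x, 0 < u x) : 0 ≤ functionalD n a c u :=
  mul_nonneg (Real.rpow_nonneg (intInvFour_pos hu.continuous hpos).le _)
    (energy_nonneg ha ha0 hc hlambda hu)

theorem infD_nonneg (ha : Continuous a) (ha0 : ∀ x, 0 ≤ a x)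
    (hc : Continuous c) (hlambda : 0 ≤ firstEigenvalue n a c) : 0 ≤ infD n a c := by
  refine Real.sInf_nonneg ?_
  rintro _ ⟨u, hu, hpos, rfl⟩
  exact functionalD_nonneg ha ha0 hc hlambda (hu.of_le two_le_smooth) hpos

/-- Two separate constants `d₁`, `d₂` serve both claims: in the first each solution carries its own
value of `functionalD`, in the second both carry `infD`. -/
theorem IsPositiveSolution.exists_eq_mul (ha : ContMDiff (𝓡 n) 𝓘(ℝ, ℝ) 1 a)
    (ha0 : ∀ x, 0 < a x) (hc : Continuous c) (hlambda : 0 ≤ firstEigenvalue n a c)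
    {d₁ d₂ : ℝ} (hd₁ : 0 ≤ d₁) (hd₂ : 0 ≤ d₂) (h₁ : IsPositiveSolution n a c d₁ u₁)
    (h₂ : IsPositiveSolution n a c d₂ u₂) : ∃ β : ℝ, 0 < β ∧ ∀ x, u₁ x = β * u₂ x :=
  exists_eq_mul_of_opL_eq ha ha0 hc hlambda h₁.contMDiff h₂.contMDiff h₁.pos h₂.pos
    (mul_nonneg hd₁ (Real.rpow_nonneg (intInvFour_pos h₁.contMDiff.continuous h₁.pos).le _))
    (mul_nonneg hd₂ (Real.rpow_nonneg (intInvFour_pos h₂.contMDiff.continuous h₂.pos).le _))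
    h₁.eqn h₂.eqn

end Uniqueness

end ConformalPDE

end

theorem theorem4p7 {M : Type*} [TopologicalSpace M] [T2Space M] [CompactSpace M]
    [ConnectedSpace M] [ChartedSpace (EuclideanSpace ℝ (Fin 4)) M] [IsManifold (𝓡 4) ∞ M]
    [RiemannianBundle (fun x : M ↦ TangentSpace (𝓡 4) x)]
    [IsContMDiffRiemannianBundle (𝓡 4) ∞ (EuclideanSpace ℝ (Fin 4))
      (fun x : M ↦ TangentSpace (𝓡 4) x)]
    [MeasurableSpace M] [BorelSpace M]
    (a c : M → ℝ) (ha : ContMDiff (𝓡 4) 𝓘(ℝ, ℝ) ∞ a) (ha_pos : ∀ x, 0 < a x)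
    (hc : ContMDiff (𝓡 4) 𝓘(ℝ, ℝ) ∞ c) (hlambda : 0 ≤ ConformalPDE.firstEigenvalue 4 a c) :
    (∀ u₁ u₂ : M → ℝ,
      ConformalPDE.IsPositiveSolution 4 a c (ConformalPDE.functionalD 4 a c u₁) u₁ →
      ConformalPDE.IsPositiveSolution 4 a c (ConformalPDE.functionalD 4 a c u₂) u₂ →
      ∃ β : ℝ, 0 < β ∧ ∀ x, u₁ x = β * u₂ x) ∧
    (∀ u₁ u₂ : M → ℝ,
      ConformalPDE.IsPositiveSolution 4 a c (ConformalPDE.infD 4 a c) u₁ →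
      ConformalPDE.IsPositiveSolution 4 a c (ConformalPDE.infD 4 a c) u₂ →
      ∃ β : ℝ, 0 < β ∧ ∀ x, u₁ x = β * u₂ x) := by
  have ha1 : ContMDiff (𝓡 4) 𝓘(ℝ, ℝ) 1 a := ha.of_le (by simp)
  have hD {u : M → ℝ} (d : ℝ) (h : ConformalPDE.IsPositiveSolution 4 a c d u) :
      0 ≤ ConformalPDE.functionalD 4 a c u :=
    ConformalPDE.functionalD_nonneg ha.continuous (fun x ↦ (ha_pos x).le) hc.continuous hlambda
      h.contMDiff h.pos
  have hinf : 0 ≤ ConformalPDE.infD 4 a c :=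
    ConformalPDE.infD_nonneg ha.continuous (fun x ↦ (ha_pos x).le) hc.continuous hlambda
  exact ⟨fun u₁ u₂ h₁ h₂ ↦ h₁.exists_eq_mul ha1 ha_pos hc.continuous hlambda
      (hD _ h₁) (hD _ h₂) h₂,
    fun u₁ u₂ h₁ h₂ ↦ h₁.exists_eq_mul ha1 ha_pos hc.continuous hlambda hinf hinf h₂⟩
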